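/- Let $(\Omega,\mathcal F,\mathbb P)$ be an atomless probability space, and let $\Psi:[0,\infty)\to[0,\infty)$ be a finite Young function, i.e. a continuous, nondecreasing, convex function with $\Psi(0)=0$ and $\lim_{x\to\infty}\Psi(x)=\infty$. The Orlicz heart $H^\Psi$ is the vector space of all real random variables $X$ (modulo almost sure equality) with $\mathbb E[\Psi(c|X|)]<\infty$ for all $c>0$. A law-invariant convex risk measure on $H^\Psi$ is a map $\rho:H^\Psi\to\mathbb R$ such that (i) $\rho(X)\ge\rho(Y)$ whenever $X\le Y$ a.s., (ii) $\rho(\lambda X+(1-\lambda)Y)\le\lambda\rho(X)+(1-\lambda)\rho(Y)$ for $\lambda\in[0,1]$, and (iii) $\rho(X)=\rho(Y)$ whenever $X$ and $Y$ have the same law. Let $\mathcal M(H^\Psi)$ be the set of laws of elements of $H^\Psi$. The risk functional of $\rho$ is the map $\mathcal R_\rho:\mathcal M(H^\Psi)\to\mathbb R$ with $\mathcal R_\rho(\mathbb P\circ X^{-1})=\rho(X)$ for all $X\in H^\Psi$. Put $\psi:=\Psi(|\cdot|)$ on $\mathbb R$, and let $\mathcal M_1^\psi$ be the set of Borel probability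 measures $\mu$ on $\mathbb R$ with $\int\psi\,d\mu<\infty$. The $\psi$-weak topology on $\mathcal M_1^\psi$ is the coarsest topology for which $\mu\mapsto\int f\,d\mu$ is continuous for every continuous $f:\mathbb R\to\mathbb R$ with $\sup_x|f(x)|/(1+\psi(x))<\infty$; the set $\mathcal M(H^\Psi)\subseteq\mathcal M_1^\psi$ carries the relative topology. (a) The following two conditions are equivalent: (1) for every law-invariant convex risk measure $\rho$ on $H^\Psi$, the map $\mathcal R_\rho:\mathcal M(H^\Psi)\to\mathbb R$ is continuous for the $\psi$-weak topology; (2) $\Psi$ satisfies the $\Delta_2$-condition: there are $C,x_0>0$ such that $\Psi(2x)\le C\,\Psi(x)$ for all $x\ge x_0$. (b) Suppose that $\Psi$ does not satisfy the $\Delta_2$-condition. Then for every $x_0>0$ the utility-based shortfall risk measure with loss function $x\mapsto\Psi(8x^+)$, $$\rho(X):=\inf\{m\in\mathbb R:\ \mathbb E[\Psi(8(-X-m)^+)]\le x_0\},\qquad X\in H^\Psi,$$ is well defined (the set on the right is non-empty and bounded below for every $X\in H^\Psi$), it is a law-invariant convex risk measure on $H^\Psi$, and its risk functional $\mathcal R_\rho:\mathcal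 M(H^\Psi)\to\mathbb R$ is not continuous for the $\psi$-weak topology. -/

import Mathlib

open MeasureTheory Set Filter Topology
open scoped NNReal ENNReal

/-- A finite Young function: a continuous nondecreasing convex function `Ψ : [0,∞) → [0,∞)` with
`Ψ 0 = 0` and `Ψ x → ∞` as `x → ∞`. -/
structure FiniteYoungFunction where
  toFun : ℝ≥0 → ℝ≥0
  continuous' : Continuous toFun
  monotone' : Monotone toFun
  convex' : ConvexOn ℝ≥0 univ toFun
  map_zero' : toFun 0 = 0
  tendsto_atTop' : Tendsto toFun atTop atTop

instance : CoeFun FiniteYoungFunction (fun _ => ℝ≥0 → ℝ≥0) := ⟨FiniteYoungFunction.toFun⟩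

/-- The `Δ₂`-condition: there are `C, x₀ > 0` with `Ψ (2x) ≤ C Ψ x` for all `x ≥ x₀`. -/
def FiniteYoungFunction.Delta2 (Ψ : FiniteYoungFunction) : Prop :=
  ∃ C x₀ : ℝ≥0, 0 < C ∧ 0 < x₀ ∧ ∀ x, x₀ ≤ x → Ψ (2 * x) ≤ C * Ψ x

/-- A measure is atomless if every measurable set of positive measure has a measurable subset of
positive, strictly smaller measure. -/
def IsAtomless {Ω : Type*} [MeasurableSpace Ω] (P : Measure Ω) : Prop :=
  ∀ s, MeasurableSet s → 0 < P s → ∃ t ⊆ s, MeasurableSet t ∧ 0 < P t ∧ P t < P s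

/-- The Orlicz heart `H^Ψ`: the (classes of a.s. equal) real random variables `X` with
`E[Ψ(c|X|)] < ∞` for all `c > 0`. -/
def orliczHeart {Ω : Type*} [MeasurableSpace Ω] (Ψ : FiniteYoungFunction) (P : Measure Ω) :
    Submodule ℝ (Ω →ₘ[P] ℝ) where
  carrier := {X | ∀ c : ℝ≥0, 0 < c → ∫⁻ ω, (Ψ (c * ‖X ω‖₊) : ℝ≥0∞) ∂P < ∞}
  zero_mem' := by
    intro c _
    have h : (fun ω => (Ψ (c * ‖(0 : Ω →ₘ[P] ℝ) ω‖₊) : ℝ≥0∞)) =ᵐ[P] fun _ => 0 := by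
      filter_upwards [AEEqFun.coeFn_zero (μ := P) (α := Ω) (β := ℝ)] with ω hω
      simp [hω, Ψ.map_zero']
    rw [lintegral_congr_ae h]
    simp
  add_mem' := by
    intro X Y hX hY c hc
    have hm : AEMeasurable (fun ω => (Ψ (2 * c * ‖X ω‖₊) : ℝ≥0∞)) P :=
      (Ψ.continuous'.measurable.comp
        (X.measurable.nnnorm.const_mul _)).coe_nnreal_ennreal.aemeasurable
    refine lt_of_le_of_lt (lintegral_mono_ae (g := fun ω =>
      (Ψ (2 * c * ‖X ω‖₊) : ℝ≥0∞) + (Ψ (2 * c * ‖Y ω‖₊) : ℝ≥0∞)) ?_) ?_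
    · filter_upwards [AEEqFun.coeFn_add X Y] with ω hω
      rw [hω, Pi.add_apply, ← ENNReal.coe_add, ENNReal.coe_le_coe]
      have h1 := nnnorm_add_le (X ω) (Y ω)
      rcases le_total ‖X ω‖₊ ‖Y ω‖₊ with h | h
      · refine le_trans (Ψ.monotone' ?_) le_add_self
        calc c * ‖X ω + Y ω‖₊ ≤ c * (‖Y ω‖₊ + ‖Y ω‖₊) := by gcongr; exact h1.trans (by gcongr)
          _ = 2 * c * ‖Y ω‖₊ := by ring
      · refine le_trans (Ψ.monotone' ?_) le_self_add
        calc c * ‖X ω + Y ω‖₊ ≤ c * (‖X ω‖₊ + ‖X ω‖₊) := by gcongr; exact h1.trans (by gcongr)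
          _ = 2 * c * ‖X ω‖₊ := by ring
    · rw [lintegral_add_left' hm]
      exact ENNReal.add_lt_top.2 ⟨hX _ (by positivity), hY _ (by positivity)⟩
  smul_mem' := by
    intro a X hX c hc
    have h : (fun ω => (Ψ (c * ‖(a • X : Ω →ₘ[P] ℝ) ω‖₊) : ℝ≥0∞)) =ᵐ[P]
        fun ω => (Ψ (c * ‖a‖₊ * ‖X ω‖₊) : ℝ≥0∞) := by
      filter_upwards [AEEqFun.coeFn_smul a X] with ω hω
      rw [hω, Pi.smul_apply, smul_eq_mul, nnnorm_mul, mul_assoc]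
    rw [lintegral_congr_ae h]
    rcases eq_or_ne a 0 with rfl | ha
    · simp [Ψ.map_zero']
    · exact hX _ (mul_pos hc (nnnorm_pos.2 ha))

/-- The law `P ∘ X⁻¹` of a real random variable. -/
noncomputable def rvLaw {Ω : Type*} [MeasurableSpace Ω] {P : Measure Ω} [IsProbabilityMeasure P]
    (X : Ω →ₘ[P] ℝ) : ProbabilityMeasure ℝ :=
  ⟨P.map X, Measure.isProbabilityMeasure_map X.measurable.aemeasurable⟩

/-- Law-invariant convex risk measures on the Orlicz heart (not necessarily cash additive). -/
structure IsLawInvariantConvexRiskMeasure {Ω : Type*} [MeasurableSpace Ω]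
    {Ψ : FiniteYoungFunction} {P : Measure Ω} [IsProbabilityMeasure P]
    (ρ : orliczHeart Ψ P → ℝ) : Prop where
  antitone : ∀ X Y : orliczHeart Ψ P,
    (∀ᵐ ω ∂P, (X : Ω →ₘ[P] ℝ) ω ≤ (Y : Ω →ₘ[P] ℝ) ω) → ρ Y ≤ ρ X
  convex : ConvexOn ℝ univ ρ
  law_invariant : ∀ X Y : orliczHeart Ψ P, rvLaw (X : Ω →ₘ[P] ℝ) = rvLaw (Y : Ω →ₘ[P] ℝ) → ρ X = ρ Y

/-- `M(H^Ψ)`: the set of laws of the elements of `H^Ψ`. -/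
def heartLaws {Ω : Type*} [MeasurableSpace Ω] (Ψ : FiniteYoungFunction) (P : Measure Ω)
    [IsProbabilityMeasure P] : Set (ProbabilityMeasure ℝ) :=
  range fun X : orliczHeart Ψ P => rvLaw (X : Ω →ₘ[P] ℝ)

/-- The risk functional `R_ρ : M(H^Ψ) → ℝ` of `ρ`: its value at `μ` is the value of `ρ` at some
`X ∈ H^Ψ` with law `μ`. For law-invariant `ρ` the choice of `X` is immaterial. -/
noncomputable def riskFunctional {Ω : Type*} [MeasurableSpace Ω] {Ψ : FiniteYoungFunction}
    {P : Measure Ω} [IsProbabilityMeasure P] (ρ : orliczHeart Ψ P → ℝ) (μ : heartLaws Ψ P) : ℝ :=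
  ρ μ.2.choose

theorem riskFunctional_law {Ω : Type*} [MeasurableSpace Ω] {Ψ : FiniteYoungFunction}
    {P : Measure Ω} [IsProbabilityMeasure P] {ρ : orliczHeart Ψ P → ℝ}
    (hρ : IsLawInvariantConvexRiskMeasure ρ) (X : orliczHeart Ψ P) :
    riskFunctional ρ ⟨rvLaw (X : Ω →ₘ[P] ℝ), X, rfl⟩ = ρ X :=
  hρ.law_invariant _ _ (Exists.choose_spec (p := fun Y : orliczHeart Ψ P =>
    rvLaw (Y : Ω →ₘ[P] ℝ) = rvLaw (X : Ω →ₘ[P] ℝ)) ⟨X, rfl⟩)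

/-- `M₁^ψ`: the Borel probability measures `μ` on `ℝ` with `∫ ψ dμ < ∞`. -/
def gaugedMeasures (ψ : ℝ → ℝ≥0) : Set (ProbabilityMeasure ℝ) :=
  {μ | ∫⁻ x, (ψ x : ℝ≥0∞) ∂(μ : Measure ℝ) < ∞}

/-- `C_ψ`: the continuous `f : ℝ → ℝ` for which `|f / (1 + ψ)|` is bounded. -/
def gaugedFunctions (ψ : ℝ → ℝ≥0) : Set (ℝ → ℝ) :=
  {f | Continuous f ∧ ∃ C : ℝ, ∀ x, |f x / (1 + ψ x)| ≤ C}

/-- The `ψ`-weak topology on `M₁^ψ`: the coarsest topology for which `μ ↦ ∫ f dμ` is continuous for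
every `f ∈ C_ψ`. -/
@[reducible] noncomputable def gaugedTopology (ψ : ℝ → ℝ≥0) : TopologicalSpace (gaugedMeasures ψ) :=
  ⨅ f ∈ gaugedFunctions ψ, TopologicalSpace.induced
    (fun μ : gaugedMeasures ψ => ∫ x, f x ∂((μ : ProbabilityMeasure ℝ) : Measure ℝ)) inferInstance

/-- The gauge function `ψ = Ψ(|·|)` on `ℝ`. -/
def FiniteYoungFunction.gauge (Ψ : FiniteYoungFunction) (x : ℝ) : ℝ≥0 := Ψ ‖x‖₊

theorem heartLaws_subset {Ω : Type*} [MeasurableSpace Ω] (Ψ : FiniteYoungFunction)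
    (P : Measure Ω) [IsProbabilityMeasure P] : heartLaws Ψ P ⊆ gaugedMeasures Ψ.gauge := by
  rintro _ ⟨X, rfl⟩
  have hm : Measurable fun x : ℝ => (Ψ ‖x‖₊ : ℝ≥0∞) :=
    (Ψ.continuous'.measurable.comp measurable_nnnorm).coe_nnreal_ennreal
  have h := X.2 1 one_pos
  simp only [one_mul] at h
  change ∫⁻ x, (Ψ ‖x‖₊ : ℝ≥0∞) ∂(P.map (X : Ω →ₘ[P] ℝ)) < ∞
  rwa [lintegral_map hm (X : Ω →ₘ[P] ℝ).measurable]

/-- The relative `ψ`-weak topology, `ψ = Ψ(|·|)`, on `M(H^Ψ) ⊆ M₁^ψ`. -/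
@[reducible] noncomputable def heartLawsTopology {Ω : Type*} [MeasurableSpace Ω] (Ψ : FiniteYoungFunction)
    (P : Measure Ω) [IsProbabilityMeasure P] : TopologicalSpace (heartLaws Ψ P) :=
  TopologicalSpace.induced (inclusion (heartLaws_subset Ψ P)) (gaugedTopology Ψ.gauge)

/-- The cash amounts `m` that make the position `X` acceptable: `E[ℓ(-X - m)] ≤ x₀`. -/
def acceptableCash {Ω : Type*} [MeasurableSpace Ω] {P : Measure Ω}
    (ℓ : ℝ → ℝ≥0) (x₀ : ℝ≥0) (X : Ω →ₘ[P] ℝ) : Set ℝ :=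
  {m | ∫⁻ ω, (ℓ (-X ω - m) : ℝ≥0∞) ∂P ≤ x₀}

/-- The utility-based shortfall risk measure on `H^Ψ` with loss function `ℓ` and threshold `x₀`. -/
noncomputable def shortfallRisk {Ω : Type*} [MeasurableSpace Ω] (Ψ : FiniteYoungFunction)
    (P : Measure Ω) (ℓ : ℝ → ℝ≥0) (x₀ : ℝ≥0) (X : orliczHeart Ψ P) : ℝ :=
  sInf (acceptableCash ℓ x₀ (X : Ω →ₘ[P] ℝ))

/-- The loss function `x ↦ Ψ(a x⁺)` on `ℝ`. -/
noncomputable def FiniteYoungFunction.loss (Ψ : FiniteYoungFunction) (a : ℝ≥0) (x : ℝ) : ℝ≥0 :=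
  Ψ (a * x.toNNReal)

/-!
On an atomless space there is a uniform random variable `U`, and the quantile variables `q_μ(U)`
realise all laws at once in such a way that weak convergence of laws becomes almost sure
convergence. If moreover `∫ ψ dμ_n → ∫ ψ dμ`, then under the `Δ₂`-condition
`Ψ(c|X_n - X|) ≤ C Ψ(|X_n|) + C Ψ(|X|) + K`, and dominated convergence with convergent majorants
gives `E[Ψ(c|X_n - X|)] → 0` for every `c`. A convex antitone functional `ρ` is continuous for this
convergence: a fast subsequence satisfies `|X_{n_k} - X| ≤ Z / (k + 1)` with a single `Z` in the
Orlicz heart, and then convexity gives `|ρ(X_{n_k}) - ρ(X)| ≤ (ρ(X - Z) - ρ(X)) / (k + 1)`.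

If the `Δ₂`-condition fails, then for every factor `b > 1` there are `a_n` for which
`Ψ(b a_n) / Ψ(a_n)` is unbounded, hence probabilities `p_n` with `p_n (1 + Ψ(a_n)) → 0` but
`p_n Ψ(b a_n) > x₀`. The positions equal to `-a_n` with probability `p_n` and to `0` otherwise have
laws converging `ψ`-weakly to `δ_0`, while their shortfall risk with loss `Ψ(b x⁺)` stays
nonnegative, although the shortfall risk of `0` is strictly negative.
-/

/-- A family of measurable sets that is totally ordered by almost sure inclusion, and maximal with
that property: every measurable set comparable with all its members belongs to it. Over an atomless
measure such a chain contains sets of every measure, and it serves as the family of sublevel sets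
of a uniform random variable. -/
structure IsSaturatedAEChain {Ω : Type*} [MeasurableSpace Ω] (P : Measure Ω)
    (C : Set (Set Ω)) : Prop where
  measurableSet : ∀ A ∈ C, MeasurableSet A
  total : ∀ A ∈ C, ∀ B ∈ C, A ≤ᵐ[P] B ∨ B ≤ᵐ[P] A
  saturated : ∀ B, MeasurableSet B → (∀ D ∈ C, D ≤ᵐ[P] B ∨ B ≤ᵐ[P] D) → B ∈ C

theorem exists_isSaturatedAEChain {Ω : Type*} [MeasurableSpace Ω] (P : Measure Ω) :
    ∃ C, IsSaturatedAEChain P C := by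
  let r : {A : Set Ω // MeasurableSet A} → {A : Set Ω // MeasurableSet A} → Prop :=
    fun A B => A.1 ≤ᵐ[P] B.1
  have hmax : IsMaxChain r (maxChain r) := maxChain_spec
  refine ⟨Subtype.val '' maxChain r, ?_, ?_, fun B hB h => ?_⟩
  · rintro _ ⟨A, -, rfl⟩
    exact A.2
  · rintro _ ⟨A, hA, rfl⟩ _ ⟨B, hB, rfl⟩
    rcases eq_or_ne A B with rfl | hne
    · exact Or.inl EventuallyLE.rfl
    · exact hmax.1 hA hB hne
  · have hchain : IsChain r (insert ⟨B, hB⟩ (maxChain r)) :=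
      hmax.1.insert fun D hD _ => (h D.1 ⟨D, hD, rfl⟩).symm
    exact ⟨⟨B, hB⟩, hmax.2 hchain (subset_insert _ _) ▸ mem_insert _ _, rfl⟩

namespace IsSaturatedAEChain

variable {Ω : Type*} [MeasurableSpace Ω] {P : Measure Ω} {C : Set (Set Ω)}

theorem compl (hC : IsSaturatedAEChain P C) : IsSaturatedAEChain P (compl '' C) where
  measurableSet := by
    rintro _ ⟨A, hA, rfl⟩
    exact (hC.measurableSet A hA).compl
  total := by
    rintro _ ⟨A, hA, rfl⟩ _ ⟨B, hB, rfl⟩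
    exact (hC.total A hA B hB).symm.imp EventuallyLE.compl EventuallyLE.compl
  saturated := fun B hB h => by
    refine ⟨Bᶜ, hC.saturated _ hB.compl fun D hD => ?_, compl_compl B⟩
    refine (h Dᶜ ⟨D, hD, rfl⟩).symm.imp (fun h => ?_) (fun h => ?_)
    · simpa using h.compl
    · simpa using h.compl

theorem iUnion_mem (hC : IsSaturatedAEChain P C) {ι : Sort*} [Countable ι] {A : ι → Set Ω}
    (hA : ∀ i, A i ∈ C) : (⋃ i, A i) ∈ C := by
  refine hC.saturated _ (.iUnion fun i => hC.measurableSet _ (hA i)) fun D hD => ?_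
  by_cases h : ∃ i, D ≤ᵐ[P] A i
  · obtain ⟨i, hi⟩ := h
    exact Or.inl (hi.trans (subset_iUnion A i).eventuallyLE)
  · have hle : ∀ i, A i ≤ᵐ[P] D := fun i =>
      (hC.total D hD _ (hA i)).resolve_left (not_exists.1 h i)
    exact Or.inr ((Filter.EventuallyLE.countable_iUnion hle).trans
      (iUnion_subset fun _ => Subset.rfl).eventuallyLE)

theorem empty_mem (hC : IsSaturatedAEChain P C) : ∅ ∈ C :=
  hC.saturated ∅ .empty fun D _ => Or.inr (empty_subset D).eventuallyLE

theorem ae_le_of_measure_le [IsFiniteMeasure P] (hC : IsSaturatedAEChain P C) {A B : Set Ω}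
    (hA : A ∈ C) (hB : B ∈ C) (h : P A ≤ P B) : A ≤ᵐ[P] B :=
  (hC.total A hA B hB).elim id fun hBA =>
    (ae_eq_of_ae_subset_of_measure_ge hBA h (hC.measurableSet B hB).nullMeasurableSet
      (measure_ne_top _ _)).symm.le

theorem measure_union_le [IsFiniteMeasure P] (hC : IsSaturatedAEChain P C) {A B : Set Ω}
    (hA : A ∈ C) (hB : B ∈ C) : P (A ∪ B) ≤ max (P A) (P B) := by
  rcases le_total (P A) (P B) with h | h
  · refine le_max_of_le_right (measure_mono_ae ?_)
    simpa using (hC.ae_le_of_measure_le hA hB h).union (EventuallyLE.refl _ B)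
  · refine le_max_of_le_left (measure_mono_ae ?_)
    simpa using (EventuallyLE.refl _ A).union (hC.ae_le_of_measure_le hB hA h)

theorem measure_iUnion_le [IsFiniteMeasure P] (hC : IsSaturatedAEChain P C) {ι : Sort*}
    [Countable ι] {A : ι → Set Ω} (hA : ∀ i, A i ∈ C) {t : ℝ≥0∞} (h : ∀ i, P (A i) ≤ t) :
    P (⋃ i, A i) ≤ t := by
  rcases isEmpty_or_nonempty ι
  · simp
  obtain ⟨e, he⟩ := exists_surjective_nat ι
  rw [← he.iUnion_comp, measure_iUnion_eq_iSup_accumulate]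
  refine iSup_le fun n => ?_
  induction n with
  | zero => simpa [accumulate_zero_nat] using h (e 0)
  | succ n ih =>
    rw [accumulate_succ]
    have hmem : accumulate (fun i => A (e i)) n ∈ C :=
      hC.iUnion_mem fun i => hC.iUnion_mem fun _ => hA (e i)
    exact (hC.measure_union_le hmem (hA _)).trans (max_le ih (h _))

theorem exists_max [IsFiniteMeasure P] (hC : IsSaturatedAEChain P C) (t : ℝ≥0∞) :
    ∃ A ∈ C, P A ≤ t ∧ ∀ D ∈ C, P D ≤ t → P D ≤ P A := by
  have hne : (P '' {A | A ∈ C ∧ P A ≤ t}).Nonempty := ⟨_, ∅, ⟨hC.empty_mem, by simp⟩, rfl⟩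
  obtain ⟨u, -, hlim, hmem⟩ := exists_seq_tendsto_sSup hne (OrderTop.bddAbove _)
  choose A hA hAu using hmem
  refine ⟨⋃ n, A n, hC.iUnion_mem fun n => (hA n).1,
    hC.measure_iUnion_le (fun n => (hA n).1) fun n => (hA n).2, fun D hD hDt => ?_⟩
  calc P D ≤ sSup (P '' {A | A ∈ C ∧ P A ≤ t}) := le_sSup ⟨D, ⟨hD, hDt⟩, rfl⟩
    _ ≤ P (⋃ n, A n) := le_of_tendsto' hlim fun n => by
      rw [← hAu]
      exact measure_mono (subset_iUnion A n)

theorem exists_min [IsFiniteMeasure P] (hC : IsSaturatedAEChain P C) {t : ℝ≥0∞}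
    (ht : t ≤ P univ) : ∃ B ∈ C, t ≤ P B ∧ ∀ D ∈ C, t ≤ P D → P B ≤ P D := by
  obtain ⟨_, ⟨B, hB, rfl⟩, hBt, hBmax⟩ := hC.compl.exists_max (P univ - t)
  have measure_compl_le_iff : ∀ D ∈ C, ∀ s ≤ P univ, (P Dᶜ ≤ P univ - s ↔ s ≤ P D) := by
    intro D hD s hs
    rw [measure_compl (hC.measurableSet D hD) (measure_ne_top _ _)]
    exact ENNReal.sub_le_sub_iff_left hs (measure_ne_top _ _)
  refine ⟨B, hB, (measure_compl_le_iff B hB t ht).1 hBt, fun D hD hDt => ?_⟩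
  have hDB := hBmax Dᶜ ⟨D, hD, rfl⟩ ((measure_compl_le_iff D hD t ht).2 hDt)
  rw [measure_compl (hC.measurableSet B hB) (measure_ne_top _ _)] at hDB
  exact (measure_compl_le_iff D hD _ (measure_mono (subset_univ B))).1 hDB

theorem exists_measure_eq [IsFiniteMeasure P] (hC : IsSaturatedAEChain P C) (hP : IsAtomless P)
    {t : ℝ≥0∞} (ht : t ≤ P univ) : ∃ A ∈ C, P A = t := by
  obtain ⟨A, hA, hAt, hAmax⟩ := hC.exists_max t
  obtain ⟨B, hB, hBt, hBmin⟩ := hC.exists_min ht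
  have hmA := hC.measurableSet A hA
  have hmdiff : MeasurableSet (B \ A) := (hC.measurableSet B hB).diff hmA
  have hPB : P A + P (B \ A) = P B := by
    rw [← measure_union disjoint_sdiff_right hmdiff, union_sdiff_self]
    have hAB := (hC.ae_le_of_measure_le hA hB (hAt.trans hBt)).union (EventuallyLE.refl _ B)
    exact le_antisymm (measure_mono_ae (by simpa using hAB)) (measure_mono subset_union_right)
  suffices hnull : P (B \ A) = 0 from
    ⟨A, hA, hAt.antisymm (hBt.trans (by rw [← hPB, hnull, add_zero]))⟩
  by_contra hpos
  obtain ⟨T, hTs, hmT, hT0, hT1⟩ := hP _ hmdiff (pos_iff_ne_zero.2 hpos)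
  have hPT : P (A ∪ T) = P A + P T := measure_union (disjoint_sdiff_right.mono_right hTs) hmT
  have hTB : (A ∪ T : Set Ω) ≤ᵐ[P] B := by
    simpa using (hC.ae_le_of_measure_le hA hB (hAt.trans hBt)).union
      (hTs.trans sdiff_subset).eventuallyLE
  -- No member of `C` lies strictly between `A` and `B`, so `A ∪ T` is comparable with all of them.
  have hmem : A ∪ T ∈ C := by
    refine hC.saturated _ (hmA.union hmT) fun D hD => ?_
    refine (le_total (P D) t).imp (fun h => ?_) fun h => ?_
    · exact (hC.ae_le_of_measure_le hD hA (hAmax D hD h)).trans subset_union_left.eventuallyLE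
    · exact hTB.trans (hC.ae_le_of_measure_le hB hD (hBmin D hD h))
  rcases le_total (P (A ∪ T)) t with h | h
  · refine (hAmax _ hmem h).not_gt ?_
    rw [hPT]
    exact ENNReal.lt_add_right (measure_ne_top _ _) hT0.ne'
  · refine (hBmin _ hmem h).not_gt ?_
    rw [hPT, ← hPB]
    exact ENNReal.add_lt_add_left (measure_ne_top _ _) hT1

end IsSaturatedAEChain

namespace IsAtomless

variable {Ω : Type*} [MeasurableSpace Ω] {P : Measure Ω}

theorem exists_measure_eq [IsFiniteMeasure P] (hP : IsAtomless P) {t : ℝ≥0∞} (ht : t ≤ P univ) :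
    ∃ A, MeasurableSet A ∧ P A = t := by
  obtain ⟨C, hC⟩ := exists_isSaturatedAEChain P
  obtain ⟨A, hA, hAt⟩ := hC.exists_measure_eq hP ht
  exact ⟨A, hC.measurableSet A hA, hAt⟩

theorem exists_measure_lt_eq_min [IsProbabilityMeasure P] (hP : IsAtomless P) :
    ∃ V : Ω → ℝ≥0∞, Measurable V ∧ ∀ t, P {ω | V ω < t} = min t 1 := by
  obtain ⟨C, hC⟩ := exists_isSaturatedAEChain P
  have hex : ∀ q : ℚ, ∃ A ∈ C, P A = min (ENNReal.ofReal q) 1 := fun q =>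
    hC.exists_measure_eq hP (by simp)
  choose A hAC hA using hex
  let V : Ω → ℝ≥0∞ := fun ω => ⨅ (q : ℚ) (_ : ω ∈ A q), ENNReal.ofReal q
  have setOf_V_lt : ∀ t, {ω | V ω < t} = ⋃ (q : ℚ) (_ : ENNReal.ofReal q < t), A q := by
    intro t
    ext ω
    simp [V, iInf_lt_iff, and_comm]
  have measurableSet_V_lt : ∀ t, MeasurableSet {ω | V ω < t} := fun t => by
    rw [setOf_V_lt]
    exact .iUnion fun q => .iUnion fun _ => hC.measurableSet _ (hAC q)
  refine ⟨V, measurable_of_Iio measurableSet_V_lt, fun t => le_antisymm ?_ ?_⟩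
  · refine le_min ?_ prob_le_one
    rw [setOf_V_lt]
    refine hC.measure_iUnion_le (fun q => hC.iUnion_mem fun _ => hAC q) fun q =>
      hC.measure_iUnion_le (fun _ => hAC q) fun hq => ?_
    rw [hA]
    exact min_le_of_left_le hq.le
  · refine le_of_forall_lt fun s hs => ?_
    obtain ⟨q, -, hsq, hqt⟩ := ENNReal.lt_iff_exists_rat_btwn.1 hs
    have hqA : P (A q) = ENNReal.ofReal q :=
      (hA q).trans (min_eq_left (hqt.le.trans (min_le_right _ _)))
    calc s < P (A q) := hqA ▸ hsq
      _ ≤ P {ω | V ω < t} := measure_mono fun ω hω =>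
        show V ω < t from (iInf₂_le q hω).trans_lt (hqt.trans_le (min_le_left _ _))

theorem exists_uniform [IsProbabilityMeasure P] (hP : IsAtomless P) :
    ∃ U : Ω → ℝ, MeasurePreserving U P (volume.restrict (Ioo 0 1)) := by
  obtain ⟨V, hVm, hV⟩ := hP.exists_measure_lt_eq_min
  have hVtop : ∀ᵐ ω ∂P, V ω ≠ ∞ := by
    have h : P {ω | V ω < ∞}ᶜ = 0 := by
      rw [prob_compl_eq_zero_iff (measurableSet_lt hVm measurable_const), hV, min_eq_right le_top]
    filter_upwards [measure_eq_zero_iff_ae_notMem.1 h] with ω hω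
    simpa using hω
  refine ⟨fun ω => (V ω).toReal, hVm.ennreal_toReal, ?_⟩
  refine ext_of_generate_finite _ (BorelSpace.measurable_eq.trans (borel_eq_generateFrom_Iio ℝ))
    isPiSystem_Iio ?_ (by simp [Measure.map_apply hVm.ennreal_toReal .univ])
  rintro _ ⟨t, rfl⟩
  rw [Measure.map_apply hVm.ennreal_toReal measurableSet_Iio,
    Measure.restrict_apply measurableSet_Iio, inter_comm, Ioo_inter_Iio, Real.volume_Ioo, sub_zero,
    ENNReal.ofReal_min, ENNReal.ofReal_one, min_comm, ← hV]
  refine measure_congr ?_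
  filter_upwards [hVtop] with ω hω
  exact propext (ENNReal.lt_ofReal_iff_toReal_lt hω).symm

end IsAtomless

section Quantile

open ProbabilityTheory

/-- The lower quantile function of a probability measure on `ℝ`, i.e. the left-continuous inverse
of its distribution function. Only its values on `(0, 1)` are meaningful. -/
noncomputable def quantile (μ : Measure ℝ) (u : ℝ) : ℝ :=
  sInf {x | u ≤ cdf μ x}

theorem quantile_le_iff (μ : Measure ℝ) {u : ℝ} (hu : u ∈ Ioo (0 : ℝ) 1) {x : ℝ} :
    quantile μ u ≤ x ↔ u ≤ cdf μ x := by
  have hne : {x | u ≤ cdf μ x}.Nonempty :=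
    ((tendsto_cdf_atTop μ).eventually (lt_mem_nhds hu.2)).exists.imp fun _ => le_of_lt
  have hbdd : BddBelow {x | u ≤ cdf μ x} := by
    obtain ⟨y, hy⟩ := ((tendsto_cdf_atBot μ).eventually (gt_mem_nhds hu.1)).exists
    exact ⟨y, fun z hz => ((monotone_cdf μ).reflect_lt (hy.trans_le hz)).le⟩
  refine ⟨fun h => ?_, fun h => csInf_le hbdd h⟩
  have hright : Tendsto (cdf μ) (𝓝[>] x) (𝓝 (cdf μ x)) :=
    ((cdf μ).right_continuous x).mono_left (nhdsWithin_mono _ Ioi_subset_Ici_self)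
  refine ge_of_tendsto hright (eventually_nhdsWithin_of_forall fun y hy => ?_)
  obtain ⟨z, hz, hzy⟩ := (csInf_lt_iff hbdd hne).1 (h.trans_lt hy)
  exact le_trans hz (monotone_cdf μ hzy.le)

theorem monotoneOn_quantile (μ : Measure ℝ) : MonotoneOn (quantile μ) (Ioo 0 1) :=
  fun _ hu _ hv huv => (quantile_le_iff μ hu).2 (huv.trans ((quantile_le_iff μ hv).1 le_rfl))

theorem aemeasurable_quantile (μ : Measure ℝ) :
    AEMeasurable (quantile μ) (volume.restrict (Ioo 0 1)) :=
  aemeasurable_restrict_of_monotoneOn measurableSet_Ioo (monotoneOn_quantile μ)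

theorem map_quantile (μ : Measure ℝ) [IsProbabilityMeasure μ] :
    (volume.restrict (Ioo 0 1)).map (quantile μ) = μ := by
  have : IsFiniteMeasure ((volume.restrict (Ioo (0 : ℝ) 1)).map (quantile μ)) :=
    Measure.isFiniteMeasure_map _ _
  refine Measure.ext_of_Iic _ _ fun x => ?_
  have hpre : (quantile μ ⁻¹' Iic x : Set ℝ) =ᵐ[volume.restrict (Ioo 0 1)] Iic (cdf μ x) := by
    filter_upwards [ae_restrict_mem measurableSet_Ioo] with u hu
    exact propext (quantile_le_iff μ hu)
  have hIio : (Iic (cdf μ x) : Set ℝ) =ᵐ[volume.restrict (Ioo 0 1)] Iio (cdf μ x) :=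
    ae_restrict_of_ae Iio_ae_eq_Iic.symm
  rw [Measure.map_apply_of_aemeasurable (aemeasurable_quantile μ) measurableSet_Iic,
    measure_congr (hpre.trans hIio), Measure.restrict_apply measurableSet_Iio, inter_comm,
    Ioo_inter_Iio, Real.volume_Ioo, sub_zero, min_eq_right (cdf_le_one μ x), ofReal_cdf]

theorem tendsto_cdf {ι : Type*} {l : Filter ι} {μs : ι → ProbabilityMeasure ℝ}
    {μ : ProbabilityMeasure ℝ} (h : Tendsto μs l (𝓝 μ)) {x : ℝ} (hx : (μ : Measure ℝ) {x} = 0) :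
    Tendsto (fun i => cdf (μs i : Measure ℝ) x) l (𝓝 (cdf (μ : Measure ℝ) x)) := by
  simp only [cdf_eq_real]
  exact (ENNReal.tendsto_toReal (measure_ne_top _ _)).comp
    (ProbabilityMeasure.tendsto_measure_of_null_frontier_of_tendsto' h (by rwa [frontier_Iic]))

theorem exists_mem_Ioo_measure_singleton_eq_zero (μ : Measure ℝ) [SFinite μ] {a b : ℝ}
    (hab : a < b) : ∃ x ∈ Ioo a b, μ {x} = 0 := by
  have hatoms : {x : ℝ | 0 < μ {x}}.Countable :=
    Measure.countable_meas_pos_of_disjoint_iUnion measurableSet_singleton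
      fun x y hxy => by simpa using hxy
  obtain ⟨x, hx, hxab⟩ := (hatoms.dense_compl ℝ).exists_between hab
  exact ⟨x, hxab, by simpa using hx⟩

-- `hne` excludes every level at which `cdf μ` is flat, that is, every jump of `quantile μ`.
theorem tendsto_quantile {ι : Type*} {l : Filter ι} {μs : ι → ProbabilityMeasure ℝ}
    {μ : ProbabilityMeasure ℝ} (h : Tendsto μs l (𝓝 μ)) {u : ℝ} (hu : u ∈ Ioo (0 : ℝ) 1)
    (hne : ∀ q : ℚ, u ≠ cdf (μ : Measure ℝ) q) :
    Tendsto (fun i => quantile (μs i) u) l (𝓝 (quantile μ u)) := by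
  refine tendsto_order.2 ⟨fun a ha => ?_, fun b hb => ?_⟩
  · obtain ⟨x, ⟨hax, hx⟩, hx0⟩ := exists_mem_Ioo_measure_singleton_eq_zero μ ha
    rw [← not_le, quantile_le_iff _ hu, not_le] at hx
    filter_upwards [(tendsto_cdf h hx0).eventually (gt_mem_nhds hx)] with i hi
    rw [← not_le, ← quantile_le_iff _ hu, not_le] at hi
    exact hax.trans hi
  · obtain ⟨q, hq, hqb⟩ := exists_rat_btwn hb
    obtain ⟨x, ⟨hqx, hxb⟩, hx0⟩ := exists_mem_Ioo_measure_singleton_eq_zero μ hqb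
    have hux : u < cdf (μ : Measure ℝ) x :=
      (((quantile_le_iff _ hu).1 hq.le).lt_of_ne (hne q)).trans_le (monotone_cdf _ hqx.le)
    filter_upwards [(tendsto_cdf h hx0).eventually (lt_mem_nhds hux)] with i hi
    exact ((quantile_le_iff _ hu).2 hi.le).trans_lt hxb

theorem ae_tendsto_quantile {ι : Type*} {l : Filter ι} {μs : ι → ProbabilityMeasure ℝ}
    {μ : ProbabilityMeasure ℝ} (h : Tendsto μs l (𝓝 μ)) :
    ∀ᵐ u ∂volume.restrict (Ioo (0 : ℝ) 1),
      Tendsto (fun i => quantile (μs i) u) l (𝓝 (quantile μ u)) := by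
  have hne : ∀ᵐ u : ℝ, ∀ q : ℚ, u ≠ cdf (μ : Measure ℝ) q :=
    ae_all_iff.2 fun q => Measure.ae_ne volume _
  filter_upwards [ae_restrict_mem measurableSet_Ioo, ae_restrict_of_ae hne] with u hu hu'
  exact tendsto_quantile h hu hu'

end Quantile

theorem IsAtomless.exists_skorokhod_representation {Ω : Type*} [MeasurableSpace Ω] {P : Measure Ω}
    [IsProbabilityMeasure P] (hP : IsAtomless P) :
    ∃ X : ProbabilityMeasure ℝ → (Ω →ₘ[P] ℝ), (∀ μ, rvLaw (X μ) = μ) ∧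
      ∀ (μs : ℕ → ProbabilityMeasure ℝ) (μ : ProbabilityMeasure ℝ), Tendsto μs atTop (𝓝 μ) →
        ∀ᵐ ω ∂P, Tendsto (fun n => X (μs n) ω) atTop (𝓝 (X μ ω)) := by
  obtain ⟨U, hU⟩ := hP.exists_uniform
  have hm : ∀ μ : Measure ℝ, AEStronglyMeasurable (quantile μ ∘ U) P := fun μ =>
    ((hU.map_eq ▸ aemeasurable_quantile μ).comp_measurable hU.measurable).aestronglyMeasurable
  have hcoe : ∀ μ : Measure ℝ, AEEqFun.mk _ (hm μ) =ᵐ[P] quantile μ ∘ U := fun μ =>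
    AEEqFun.coeFn_mk _ _
  refine ⟨fun μ => AEEqFun.mk _ (hm μ), fun μ => Subtype.ext ?_, fun μs μ h => ?_⟩
  · calc P.map (AEEqFun.mk _ (hm μ)) = P.map (quantile μ ∘ U) := Measure.map_congr (hcoe μ)
      _ = (P.map U).map (quantile μ) := (AEMeasurable.map_map_of_aemeasurable
        (hU.map_eq ▸ aemeasurable_quantile μ) hU.aemeasurable).symm
      _ = μ := by rw [hU.map_eq, map_quantile]
  · have hlim := hU.quasiMeasurePreserving.ae (ae_tendsto_quantile h)
    filter_upwards [hlim, hcoe μ, ae_all_iff.2 fun n => hcoe (μs n)] with ω hω hμ hμs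
    simpa only [hμ, hμs, Function.comp_apply] using hω

theorem tendsto_lintegral_tsub_zero {Ω : Type*} [MeasurableSpace Ω] {P : Measure Ω}
    {g : ℕ → Ω → ℝ≥0∞} {G : Ω → ℝ≥0∞} (hg : ∀ n, AEMeasurable (g n) P)
    (hgG : ∀ᵐ ω ∂P, Tendsto (fun n => g n ω) atTop (𝓝 (G ω))) (hG : ∫⁻ ω, G ω ∂P ≠ ∞)
    (hint : Tendsto (fun n => ∫⁻ ω, g n ω ∂P) atTop (𝓝 (∫⁻ ω, G ω ∂P))) :
    Tendsto (fun n => ∫⁻ ω, (g n ω - G ω) ∂P) atTop (𝓝 0) := by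
  have hGm : AEMeasurable G P := aemeasurable_of_tendsto_metrizable_ae' hg hgG
  have hmin_le : ∀ n, ∫⁻ ω, min (g n ω) (G ω) ∂P ≤ ∫⁻ ω, G ω ∂P := fun n =>
    lintegral_mono fun ω => min_le_right _ _
  have hmin : Tendsto (fun n => ∫⁻ ω, min (g n ω) (G ω) ∂P) atTop (𝓝 (∫⁻ ω, G ω ∂P)) := by
    refine tendsto_lintegral_of_dominated_convergence' G (fun n => (hg n).min hGm)
      (fun n => ae_of_all _ fun ω => min_le_right _ _) hG ?_
    filter_upwards [hgG] with ω hω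
    simpa using hω.min (tendsto_const_nhds (x := G ω))
  have hsub : ∀ n, ∫⁻ ω, (g n ω - G ω) ∂P =
      ∫⁻ ω, g n ω ∂P - ∫⁻ ω, min (g n ω) (G ω) ∂P := fun n => by
    rw [← lintegral_sub' ((hg n).min hGm) ((hmin_le n).trans_lt hG.lt_top).ne
      (ae_of_all _ fun ω => min_le_left _ _)]
    exact lintegral_congr fun ω => tsub_min.symm
  simpa only [hsub, tsub_self] using ENNReal.Tendsto.sub hint hmin (Or.inl hG)

theorem tendsto_lintegral_of_le_of_tendsto {Ω : Type*} [MeasurableSpace Ω] {P : Measure Ω}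
    {f g : ℕ → Ω → ℝ≥0∞} {F G : Ω → ℝ≥0∞} (hf : ∀ n, AEMeasurable (f n) P)
    (hg : ∀ n, AEMeasurable (g n) P) (hfg : ∀ n, f n ≤ᵐ[P] g n)
    (hfF : ∀ᵐ ω ∂P, Tendsto (fun n => f n ω) atTop (𝓝 (F ω)))
    (hgG : ∀ᵐ ω ∂P, Tendsto (fun n => g n ω) atTop (𝓝 (G ω))) (hG : ∫⁻ ω, G ω ∂P ≠ ∞)
    (hint : Tendsto (fun n => ∫⁻ ω, g n ω ∂P) atTop (𝓝 (∫⁻ ω, G ω ∂P))) :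
    Tendsto (fun n => ∫⁻ ω, f n ω ∂P) atTop (𝓝 (∫⁻ ω, F ω ∂P)) := by
  have hGm : AEMeasurable G P := aemeasurable_of_tendsto_metrizable_ae' hg hgG
  have hmin : Tendsto (fun n => ∫⁻ ω, min (f n ω) (G ω) ∂P) atTop (𝓝 (∫⁻ ω, F ω ∂P)) := by
    refine tendsto_lintegral_of_dominated_convergence' G (fun n => (hf n).min hGm)
      (fun n => ae_of_all _ fun ω => min_le_right _ _) hG ?_
    filter_upwards [hfF, hgG, ae_all_iff.2 hfg] with ω hF hG' hle
    simpa [le_of_tendsto_of_tendsto' hF hG' hle] using hF.min (tendsto_const_nhds (x := G ω))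
  -- `f n ≤ min (f n) G + (g n - G)`, and the last term vanishes in mean by Scheffé's lemma.
  have hupper := hmin.add (tendsto_lintegral_tsub_zero hg hgG hG hint)
  rw [add_zero] at hupper
  refine tendsto_of_tendsto_of_tendsto_of_le_of_le hmin hupper
    (fun n => lintegral_mono fun ω => min_le_left _ _) fun n => ?_
  rw [← lintegral_add_left' ((hf n).min hGm)]
  refine lintegral_mono_ae ?_
  filter_upwards [hfg n] with ω hω
  rcases le_total (f n ω) (G ω) with h | h
  · simp [h]
  · rw [min_eq_right h]
    exact hω.trans le_add_tsub

namespace FiniteYoungFunction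

variable {Ψ : FiniteYoungFunction}

theorem apply_mul_add_le (c x y : ℝ≥0) : Ψ (c * (x + y)) ≤ Ψ (2 * c * x) + Ψ (2 * c * y) := by
  rcases le_total x y with h | h
  · refine (Ψ.monotone' ?_).trans le_add_self
    calc c * (x + y) ≤ c * (y + y) := by gcongr
      _ = 2 * c * y := by ring
  · refine (Ψ.monotone' ?_).trans le_self_add
    calc c * (x + y) ≤ c * (x + x) := by gcongr
      _ = 2 * c * x := by ring

theorem apply_pow_mul_le {b C x₁ : ℝ≥0} (hb : 1 ≤ b) (h : ∀ x, x₁ ≤ x → Ψ (b * x) ≤ C * Ψ x)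
    (n : ℕ) {x : ℝ≥0} (hx : x₁ ≤ x) : Ψ (b ^ n * x) ≤ C ^ n * Ψ x := by
  induction n with
  | zero => simp
  | succ n ih =>
    calc Ψ (b ^ (n + 1) * x) = Ψ (b * (b ^ n * x)) := by ring_nf
      _ ≤ C * Ψ (b ^ n * x) := h _ (hx.trans (le_mul_of_one_le_left' (one_le_pow₀ hb)))
      _ ≤ C * (C ^ n * Ψ x) := by gcongr
      _ = C ^ (n + 1) * Ψ x := by ring

theorem delta2_iff_exists_mul_le {b : ℝ≥0} (hb : 1 < b) :
    Ψ.Delta2 ↔ ∃ C x₁ : ℝ≥0, ∀ x, x₁ ≤ x → Ψ (b * x) ≤ C * Ψ x := by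
  constructor
  · rintro ⟨C, x₀, -, -, h⟩
    obtain ⟨n, hn⟩ := pow_unbounded_of_one_lt b (one_lt_two (α := ℝ≥0))
    refine ⟨C ^ n, x₀, fun x hx => ?_⟩
    exact (Ψ.monotone' (by gcongr)).trans (apply_pow_mul_le one_le_two h n hx)
  · rintro ⟨C, x₁, h⟩
    obtain ⟨n, hn⟩ := pow_unbounded_of_one_lt 2 hb
    refine ⟨C ^ n + 1, x₁ + 1, by positivity, by positivity, fun x hx => ?_⟩
    calc Ψ (2 * x) ≤ Ψ (b ^ n * x) := Ψ.monotone' (by gcongr)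
      _ ≤ C ^ n * Ψ x := apply_pow_mul_le hb.le h n (le_self_add.trans hx)
      _ ≤ (C ^ n + 1) * Ψ x := by gcongr; exact le_self_add

theorem Delta2.exists_mul_le_add (h : Ψ.Delta2) (c : ℝ≥0) :
    ∃ C K : ℝ≥0, ∀ x, Ψ (c * x) ≤ C * Ψ x + K := by
  obtain ⟨C, x₁, hC⟩ := (delta2_iff_exists_mul_le (b := c + 2)
    (one_lt_two.trans_le le_add_self)).1 h
  refine ⟨C, Ψ (c * x₁), fun x => ?_⟩
  rcases le_total x₁ x with hx | hx
  · exact (Ψ.monotone' (by gcongr; exact le_self_add)).trans ((hC x hx).trans le_self_add)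
  · exact (Ψ.monotone' (by gcongr)).trans le_add_self

theorem Delta2.exists_mul_nnnorm_sub_le (h : Ψ.Delta2) (c : ℝ≥0) :
    ∃ C K : ℝ≥0, ∀ x y : ℝ,
      Ψ (c * ‖x - y‖₊) ≤ (C * Ψ ‖x‖₊ + K) + (C * Ψ ‖y‖₊ + K) := by
  obtain ⟨C, K, hCK⟩ := h.exists_mul_le_add (2 * c)
  refine ⟨C, K, fun x y => ?_⟩
  calc Ψ (c * ‖x - y‖₊) ≤ Ψ (c * (‖x‖₊ + ‖y‖₊)) :=
        Ψ.monotone' (by gcongr; exact nnnorm_sub_le _ _)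
    _ ≤ Ψ (2 * c * ‖x‖₊) + Ψ (2 * c * ‖y‖₊) := apply_mul_add_le _ _ _
    _ ≤ (C * Ψ ‖x‖₊ + K) + (C * Ψ ‖y‖₊ + K) := add_le_add (hCK _) (hCK _)

/-- The modular `E[Ψ(c|f|)]` of a function at scale `c`. The Orlicz heart consists of the random
variables all of whose modulars are finite. -/
noncomputable def modular (Ψ : FiniteYoungFunction) {Ω : Type*} [MeasurableSpace Ω] (P : Measure Ω)
    (c : ℝ≥0) (f : Ω → ℝ) : ℝ≥0∞ :=
  ∫⁻ ω, (Ψ (c * ‖f ω‖₊) : ℝ≥0∞) ∂P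

section Modular

variable {Ω : Type*} [MeasurableSpace Ω] {P : Measure Ω}

theorem aemeasurable_coe_mul_nnnorm (c : ℝ≥0) {f : Ω → ℝ} (hf : AEMeasurable f P) :
    AEMeasurable (fun ω => (Ψ (c * ‖f ω‖₊) : ℝ≥0∞)) P :=
  (Ψ.continuous'.measurable.comp_aemeasurable (hf.nnnorm.const_mul c)).coe_nnreal_ennreal

theorem modular_congr {c : ℝ≥0} {f g : Ω → ℝ} (h : f =ᵐ[P] g) :
    Ψ.modular P c f = Ψ.modular P c g :=
  lintegral_congr_ae (h.mono fun ω hω => by simp only [hω])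

theorem modular_smul (c : ℝ≥0) (a : ℝ) (f : Ω → ℝ) :
    Ψ.modular P c (a • f) = Ψ.modular P (c * ‖a‖₊) f := by
  simp only [modular, Pi.smul_apply, smul_eq_mul, nnnorm_mul, mul_assoc]

theorem modular_mono {c d : ℝ≥0} (h : c ≤ d) (f : Ω → ℝ) :
    Ψ.modular P c f ≤ Ψ.modular P d f :=
  lintegral_mono fun _ => ENNReal.coe_le_coe.2 (Ψ.monotone' (by gcongr))

theorem modular_lt_top (X : orliczHeart Ψ P) (c : ℝ≥0) :
    Ψ.modular P c (X : Ω →ₘ[P] ℝ) < ∞ :=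
  (modular_mono le_self_add _).trans_lt (X.2 (c + 1) (by positivity))

theorem modular_map (c : ℝ≥0) {f : Ω → ℝ} (hf : AEMeasurable f P) :
    Ψ.modular (P.map f) c id = Ψ.modular P c f :=
  lintegral_map' (aemeasurable_coe_mul_nnnorm c aemeasurable_id) hf

theorem lintegral_gauge_map {f : Ω → ℝ} (hf : AEMeasurable f P) :
    ∫⁻ x, (Ψ.gauge x : ℝ≥0∞) ∂P.map f = Ψ.modular P 1 f := by
  rw [← modular_map 1 hf]
  simp only [modular, one_mul, id, gauge]

theorem Delta2.tendsto_modular_sub [IsFiniteMeasure P] (hΨ : Ψ.Delta2) {f : ℕ → Ω → ℝ}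
    {F : Ω → ℝ} (hf : ∀ n, AEMeasurable (f n) P)
    (hlim : ∀ᵐ ω ∂P, Tendsto (fun n => f n ω) atTop (𝓝 (F ω))) (hfin : Ψ.modular P 1 F ≠ ∞)
    (hmod : Tendsto (fun n => Ψ.modular P 1 (f n)) atTop (𝓝 (Ψ.modular P 1 F))) (c : ℝ≥0) :
    Tendsto (fun n => Ψ.modular P c (f n - F)) atTop (𝓝 0) := by
  have hF : AEMeasurable F P := aemeasurable_of_tendsto_metrizable_ae' hf hlim
  obtain ⟨C, K, hCK⟩ := hΨ.exists_mul_nnnorm_sub_le c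
  let bound : (Ω → ℝ) → Ω → ℝ≥0∞ := fun h ω => (C * Ψ (1 * ‖h ω‖₊) + K : ℝ≥0)
  have hbm : ∀ {h}, AEMeasurable h P → AEMeasurable (bound h) P := fun hh =>
    ((Ψ.continuous'.measurable.comp_aemeasurable (hh.nnnorm.const_mul 1)).const_mul C
      |>.add_const K).coe_nnreal_ennreal
  have lintegral_bound : ∀ h, ∫⁻ ω, bound h ω ∂P = C * Ψ.modular P 1 h + K * P univ := fun h => by
    simp only [bound, ENNReal.coe_add, ENNReal.coe_mul]
    rw [lintegral_add_right _ measurable_const, lintegral_const_mul' _ _ ENNReal.coe_ne_top,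
      lintegral_const, modular]
  have hzero : Tendsto (fun n => Ψ.modular P c (f n - F)) atTop (𝓝 (∫⁻ _, 0 ∂P)) := by
    refine tendsto_lintegral_of_le_of_tendsto (g := fun n ω => bound (f n) ω + bound F ω)
      (G := fun ω => bound F ω + bound F ω)
      (fun n => aemeasurable_coe_mul_nnnorm c ((hf n).sub hF))
      (fun n => (hbm (hf n)).add (hbm hF)) (fun n => ae_of_all _ fun ω => ?_) ?_ ?_ ?_ ?_
    · simp only [bound, one_mul]
      exact_mod_cast hCK (f n ω) (F ω)
    · filter_upwards [hlim] with ω hω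
      have h := (Ψ.continuous'.tendsto _).comp ((hω.sub_const (F ω)).nnnorm.const_mul c)
      rw [sub_self, nnnorm_zero, mul_zero, Ψ.map_zero'] at h
      exact (ENNReal.continuous_coe.tendsto _).comp h
    · filter_upwards [hlim] with ω hω
      have h := (Ψ.continuous'.tendsto _).comp (hω.nnnorm.const_mul 1)
      exact ((ENNReal.continuous_coe.tendsto _).comp ((h.const_mul C).add_const K)).add_const _
    · rw [lintegral_add_left' (hbm hF), lintegral_bound]
      finiteness
    · simp only [lintegral_add_right' _ (hbm hF), lintegral_bound]
      exact ((ENNReal.Tendsto.const_mul hmod (Or.inr ENNReal.coe_ne_top)).add_const _).add_const _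
  simpa only [lintegral_zero] using hzero

theorem bddAbove_range_of_tsum_ne_top {ι : Type*} {b : ι → ℝ≥0}
    (h : ∑' i, (Ψ (b i) : ℝ≥0∞) ≠ ∞) : BddAbove (range b) := by
  lift (∑' i, (Ψ (b i) : ℝ≥0∞)) to ℝ≥0 using h with S hS
  obtain ⟨M, hM⟩ := (Ψ.tendsto_atTop'.eventually (eventually_gt_atTop S)).exists
  refine ⟨M, forall_mem_range.2 fun i => (Ψ.monotone'.reflect_lt (lt_of_le_of_lt ?_ hM)).le⟩
  exact ENNReal.coe_le_coe.1 (hS ▸ ENNReal.le_tsum i)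

theorem coe_mul_iSup_le_tsum {ι : Type*} (c : ℝ≥0) (b : ι → ℝ≥0) :
    (Ψ (c * ⨆ i, b i) : ℝ≥0∞) ≤ ∑' i, (Ψ (c * b i) : ℝ≥0∞) := by
  rcases eq_or_ne (∑' i, (Ψ (c * b i) : ℝ≥0∞)) ∞ with htop | htop
  · exact htop ▸ le_top
  lift (∑' i, (Ψ (c * b i) : ℝ≥0∞)) to ℝ≥0 using htop with S hS
  have hle : ∀ i, Ψ (c * b i) ≤ S := fun i => ENNReal.coe_le_coe.1 (hS ▸ ENNReal.le_tsum i)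
  rw [ENNReal.coe_le_coe, NNReal.mul_iSup]
  rcases isEmpty_or_nonempty ι
  · simp [Ψ.map_zero']
  by_cases hbdd : BddAbove (range fun i => c * b i)
  · rw [Ψ.monotone'.map_ciSup_of_continuousAt Ψ.continuous'.continuousAt hbdd]
    exact ciSup_le hle
  · simp [NNReal.iSup_of_not_bddAbove hbdd, Ψ.map_zero']

theorem mk_mem_orliczHeart {f : Ω → ℝ} (hf : AEStronglyMeasurable f P)
    (h : ∀ c : ℝ≥0, Ψ.modular P c f < ∞) : AEEqFun.mk f hf ∈ orliczHeart Ψ P :=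
  fun c _ => (modular_congr (AEEqFun.coeFn_mk f hf)).trans_lt (h c)

theorem tsum_modular_ne_top {W : ℕ → orliczHeart Ψ P}
    (hW : ∑' k : ℕ, Ψ.modular P k (W k : Ω →ₘ[P] ℝ) ≠ ∞) (c : ℝ≥0) :
    ∑' k, Ψ.modular P c (W k : Ω →ₘ[P] ℝ) ≠ ∞ := by
  obtain ⟨N, hN⟩ := exists_nat_ge c
  rw [← ENNReal.summable.sum_add_tsum_nat_add' (k := N)]
  refine ENNReal.add_ne_top.2 ⟨ENNReal.sum_ne_top.2 fun k _ => (modular_lt_top _ c).ne,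
    ne_top_of_le_ne_top hW ?_⟩
  calc ∑' k, Ψ.modular P c (W (k + N) : Ω →ₘ[P] ℝ)
      ≤ ∑' k : ℕ, Ψ.modular P ((k + N : ℕ) : ℝ≥0) (W (k + N) : Ω →ₘ[P] ℝ) :=
        ENNReal.tsum_le_tsum fun k => modular_mono (hN.trans (by simp)) _
    _ ≤ ∑' k : ℕ, Ψ.modular P k (W k : Ω →ₘ[P] ℝ) :=
        ENNReal.tsum_comp_le_tsum_of_injective (add_left_injective N)
          fun k : ℕ => Ψ.modular P k (W k : Ω →ₘ[P] ℝ)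

theorem exists_forall_abs_le {W : ℕ → orliczHeart Ψ P}
    (hW : ∑' k : ℕ, Ψ.modular P k (W k : Ω →ₘ[P] ℝ) ≠ ∞) :
    ∃ Z : orliczHeart Ψ P,
      ∀ᵐ ω ∂P, ∀ k, |(W k : Ω →ₘ[P] ℝ) ω| ≤ (Z : Ω →ₘ[P] ℝ) ω := by
  let Z : Ω → ℝ := fun ω => (⨆ k, ‖(W k : Ω →ₘ[P] ℝ) ω‖₊ : ℝ≥0)
  have hZm : AEStronglyMeasurable Z P :=
    (Measurable.iSup fun k => (W k : Ω →ₘ[P] ℝ).measurable.nnnorm).coe_nnreal_real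
      |>.aestronglyMeasurable
  have hmeas : ∀ (c : ℝ≥0) k, AEMeasurable (fun ω => (Ψ (c * ‖(W k : Ω →ₘ[P] ℝ) ω‖₊) : ℝ≥0∞)) P :=
    fun c k => aemeasurable_coe_mul_nnnorm c (W k : Ω →ₘ[P] ℝ).measurable.aemeasurable
  have hfin : ∀ c : ℝ≥0, ∫⁻ ω, ∑' k, (Ψ (c * ‖(W k : Ω →ₘ[P] ℝ) ω‖₊) : ℝ≥0∞) ∂P ≠ ∞ := fun c => by
    rw [lintegral_tsum (hmeas c)]
    exact tsum_modular_ne_top hW c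
  have hZ : ∀ c, Ψ.modular P c Z < ∞ := fun c => by
    refine (lintegral_mono fun ω => ?_).trans_lt (hfin c).lt_top
    rw [NNReal.nnnorm_eq]
    exact coe_mul_iSup_le_tsum c _
  refine ⟨⟨_, mk_mem_orliczHeart hZm hZ⟩, ?_⟩
  filter_upwards [ae_lt_top' (AEMeasurable.tsum (hmeas 1)) (hfin 1),
    AEEqFun.coeFn_mk Z hZm] with ω hω hmk k
  simp only [one_mul] at hω
  rw [hmk]
  exact_mod_cast le_ciSup (bddAbove_range_of_tsum_ne_top hω.ne) k

end Modular

end FiniteYoungFunction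

theorem abs_add_sub_le_of_convexOn {E : Type*} [AddCommGroup E] [Module ℝ E] {ρ : E → ℝ}
    (hρ : ConvexOn ℝ univ ρ) {t : ℝ} (ht₀ : 0 ≤ t) (ht₁ : t ≤ 1) {x v z : E}
    (hadd : ρ (x + v) ≤ ρ (x + t • z)) (hsub : ρ (x - v) ≤ ρ (x + t • z)) :
    |ρ (x + v) - ρ x| ≤ t * (ρ (x + z) - ρ x) := by
  have hseg : ρ (x + t • z) ≤ (1 - t) * ρ x + t * ρ (x + z) := by
    have h := hρ.2 (mem_univ x) (mem_univ (x + z)) (sub_nonneg.2 ht₁) ht₀ (sub_add_cancel 1 t)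
    rwa [show (1 - t) • x + t • (x + z) = x + t • z by module] at h
  have hmid : ρ x ≤ 1 / 2 * ρ (x + v) + 1 / 2 * ρ (x - v) := by
    have h := hρ.2 (mem_univ (x + v)) (mem_univ (x - v)) one_half_pos.le one_half_pos.le
      (add_halves (1 : ℝ))
    rwa [show (1 / 2 : ℝ) • (x + v) + (1 / 2 : ℝ) • (x - v) = x by module] at h
  rw [abs_le]
  constructor <;> linarith

section ConvexAntitone

variable {Ω : Type*} [MeasurableSpace Ω] {Ψ : FiniteYoungFunction} {P : Measure Ω}
  {ρ : orliczHeart Ψ P → ℝ}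

theorem abs_add_sub_le_of_antitone_of_convexOn
    (hanti : ∀ X Y : orliczHeart Ψ P,
      (∀ᵐ ω ∂P, (X : Ω →ₘ[P] ℝ) ω ≤ (Y : Ω →ₘ[P] ℝ) ω) → ρ Y ≤ ρ X)
    (hconv : ConvexOn ℝ univ ρ) {t : ℝ} (ht₀ : 0 ≤ t) (ht₁ : t ≤ 1) {X V Z : orliczHeart Ψ P}
    (hV : ∀ᵐ ω ∂P, |(V : Ω →ₘ[P] ℝ) ω| ≤ t * (Z : Ω →ₘ[P] ℝ) ω) :
    |ρ (X + V) - ρ X| ≤ t * (ρ (X - Z) - ρ X) := by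
  rw [sub_eq_add_neg X Z]
  refine abs_add_sub_le_of_convexOn hconv ht₀ ht₁ (hanti _ _ ?_) (hanti _ _ ?_)
  all_goals
    rw [smul_neg, ← sub_eq_add_neg]
    simp only [Submodule.coe_sub, Submodule.coe_add, Submodule.coe_smul]
    filter_upwards [hV, AEEqFun.coeFn_sub (X : Ω →ₘ[P] ℝ) (t • (Z : Ω →ₘ[P] ℝ)),
      AEEqFun.coeFn_add (X : Ω →ₘ[P] ℝ) V, AEEqFun.coeFn_sub (X : Ω →ₘ[P] ℝ) V,
      AEEqFun.coeFn_smul t (Z : Ω →ₘ[P] ℝ)] with ω hω hXZ hXV hXV' hZ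
    simp only [hXZ, hXV, hXV', hZ, Pi.sub_apply, Pi.add_apply, Pi.smul_apply, smul_eq_mul]
    linarith [(abs_le.1 hω).1, (abs_le.1 hω).2]

theorem exists_forall_abs_le_one_div_mul {W : ℕ → orliczHeart Ψ P}
    (hW : ∀ k : ℕ, Ψ.modular P (k * (k + 1)) (W k : Ω →ₘ[P] ℝ) ≤ 2⁻¹ ^ k) :
    ∃ Z : orliczHeart Ψ P,
      ∀ᵐ ω ∂P, ∀ k : ℕ, |(W k : Ω →ₘ[P] ℝ) ω| ≤ 1 / ((k : ℝ) + 1) * (Z : Ω →ₘ[P] ℝ) ω := by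
  have hcoe : ∀ k : ℕ, ((((k : ℝ) + 1) • W k : orliczHeart Ψ P) : Ω →ₘ[P] ℝ) =ᵐ[P]
      ((k : ℝ) + 1) • ⇑(W k : Ω →ₘ[P] ℝ) := fun k => AEEqFun.coeFn_smul _ _
  have hsmul : ∀ k : ℕ, Ψ.modular P k ((((k : ℝ) + 1) • W k : orliczHeart Ψ P) : Ω →ₘ[P] ℝ) =
      Ψ.modular P (k * (k + 1)) (W k : Ω →ₘ[P] ℝ) := fun k => by
    rw [FiniteYoungFunction.modular_congr (hcoe k), ← Nat.cast_add_one (R := ℝ),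
      FiniteYoungFunction.modular_smul, Real.nnnorm_natCast, Nat.cast_add_one]
  obtain ⟨Z, hZ⟩ := FiniteYoungFunction.exists_forall_abs_le
    (W := fun k => ((k : ℝ) + 1) • W k) (ne_top_of_le_ne_top (b := ∑' k, (2⁻¹ : ℝ≥0∞) ^ k)
      (by simp) (ENNReal.tsum_le_tsum fun k => hsmul k ▸ hW k))
  refine ⟨Z, ?_⟩
  filter_upwards [hZ, ae_all_iff.2 hcoe] with ω hω hcoeω k
  have hk : (0 : ℝ) < k + 1 := by positivity
  have h := hω k
  rw [hcoeω k, Pi.smul_apply, smul_eq_mul, abs_mul, abs_of_pos hk] at h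
  rwa [one_div, ← div_eq_inv_mul, le_div_iff₀' hk]

theorem tendsto_of_antitone_of_convexOn
    (hanti : ∀ X Y : orliczHeart Ψ P,
      (∀ᵐ ω ∂P, (X : Ω →ₘ[P] ℝ) ω ≤ (Y : Ω →ₘ[P] ℝ) ω) → ρ Y ≤ ρ X)
    (hconv : ConvexOn ℝ univ ρ) {Xs : ℕ → orliczHeart Ψ P} {X : orliczHeart Ψ P}
    (h : ∀ c, Tendsto (fun n => Ψ.modular P c ((Xs n - X : orliczHeart Ψ P) : Ω →ₘ[P] ℝ))
      atTop (𝓝 0)) :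
    Tendsto (fun n => ρ (Xs n)) atTop (𝓝 (ρ X)) := by
  refine tendsto_of_subseq_tendsto fun ns hns => ?_
  have hsmall : ∀ k : ℕ, ∃ m, Ψ.modular P (k * (k + 1))
      ((Xs (ns m) - X : orliczHeart Ψ P) : Ω →ₘ[P] ℝ) ≤ 2⁻¹ ^ k := fun k =>
    (((h (k * (k + 1))).comp hns).eventually (ge_mem_nhds (ENNReal.pow_pos (by simp) k))).exists
  choose ms hms using hsmall
  obtain ⟨Z, hZ⟩ := exists_forall_abs_le_one_div_mul hms
  refine ⟨ms, tendsto_iff_norm_sub_tendsto_zero.2 (squeeze_zero (fun k => norm_nonneg _)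
    (g := fun k : ℕ => 1 / ((k : ℝ) + 1) * (ρ (X - Z) - ρ X)) (fun k => ?_) ?_)⟩
  · have hbound := abs_add_sub_le_of_antitone_of_convexOn hanti hconv (X := X)
      Nat.one_div_pos_of_nat.le (div_le_one_of_le₀ (by simp) (by positivity))
      (hZ.mono fun ω hω => hω k)
    rwa [add_sub_cancel] at hbound
  · simpa only [zero_mul] using
      tendsto_one_div_add_atTop_nhds_zero_nat.mul_const (ρ (X - Z) - ρ X)

end ConvexAntitone

section GaugedTopology

variable {ψ : ℝ → ℝ≥0}

theorem tendsto_nhds_gaugedTopology_iff {ι : Type*} {l : Filter ι} {μs : ι → gaugedMeasures ψ}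
    {μ : gaugedMeasures ψ} :
    Tendsto μs l (@nhds _ (gaugedTopology ψ) μ) ↔ ∀ f ∈ gaugedFunctions ψ,
      Tendsto (fun i => ∫ x, f x ∂((μs i : ProbabilityMeasure ℝ) : Measure ℝ)) l
        (𝓝 (∫ x, f x ∂((μ : ProbabilityMeasure ℝ) : Measure ℝ))) := by
  simp only [nhds_iInf, nhds_induced, tendsto_iInf, tendsto_comap_iff, Function.comp_def]

theorem continuous_integral_gaugedMeasures {f : ℝ → ℝ} (hf : f ∈ gaugedFunctions ψ) :
    Continuous[gaugedTopology ψ, inferInstance] (fun μ : gaugedMeasures ψ =>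
      ∫ x, f x ∂((μ : ProbabilityMeasure ℝ) : Measure ℝ)) :=
  let := gaugedTopology ψ
  continuous_iff_continuousAt.2 fun _ => tendsto_nhds_gaugedTopology_iff.1 tendsto_id f hf

theorem boundedContinuous_mem_gaugedFunctions (f : BoundedContinuousFunction ℝ ℝ) :
    ⇑f ∈ gaugedFunctions ψ := by
  refine ⟨f.continuous, ‖f‖, fun x => ?_⟩
  have hpos : (0 : ℝ) < 1 + ψ x := by positivity
  rw [abs_div, abs_of_pos hpos]
  exact (div_le_self (abs_nonneg _) (by simp)).trans (f.norm_coe_le_norm x)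

theorem coe_gauge_mem_gaugedFunctions (hψ : Continuous ψ) :
    (fun x => (ψ x : ℝ)) ∈ gaugedFunctions ψ := by
  refine ⟨NNReal.continuous_coe.comp hψ, 1, fun x => ?_⟩
  rw [abs_of_nonneg (by positivity)]
  exact div_le_one_of_le₀ (by simp) (by positivity)

theorem continuous_coe_gaugedMeasures :
    Continuous[gaugedTopology ψ, inferInstance]
      ((↑) : gaugedMeasures ψ → ProbabilityMeasure ℝ) :=
  let := gaugedTopology ψ
  ProbabilityMeasure.continuous_iff_forall_continuous_integral.2 fun f =>
    continuous_integral_gaugedMeasures (boundedContinuous_mem_gaugedFunctions f)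

theorem continuous_lintegral_gaugedMeasures (hψ : Continuous ψ) :
    Continuous[gaugedTopology ψ, inferInstance] (fun μ : gaugedMeasures ψ =>
      ∫⁻ x, (ψ x : ℝ≥0∞) ∂((μ : ProbabilityMeasure ℝ) : Measure ℝ)) := by
  have hofReal : ∀ μ : gaugedMeasures ψ,
      ∫⁻ x, (ψ x : ℝ≥0∞) ∂((μ : ProbabilityMeasure ℝ) : Measure ℝ) =
        ENNReal.ofReal (∫ x, (ψ x : ℝ) ∂((μ : ProbabilityMeasure ℝ) : Measure ℝ)) := fun μ =>
    lintegral_coe_eq_integral _ ⟨(NNReal.continuous_coe.comp hψ).aestronglyMeasurable, by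
      simp only [HasFiniteIntegral, NNReal.enorm_eq]; exact μ.2⟩
  let := gaugedTopology ψ
  simp only [hofReal]
  exact ENNReal.continuous_ofReal.comp
    (continuous_integral_gaugedMeasures (coe_gauge_mem_gaugedFunctions hψ))

end GaugedTopology

theorem continuous_of_forall_seq_tendsto_comp {X Y Z : Type*} [TopologicalSpace X]
    [TopologicalSpace Y] [FirstCountableTopology Y] [TopologicalSpace Z] {g : X → Y} {f : X → Z}
    (hg : Continuous g) (h : ∀ (xs : ℕ → X) (x : X),
      Tendsto (g ∘ xs) atTop (𝓝 (g x)) → Tendsto (f ∘ xs) atTop (𝓝 (f x))) :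
    Continuous f := by
  refine continuous_le_dom (continuous_iff_le_induced.1 hg) ?_
  let := TopologicalSpace.induced g inferInstance
  have : FirstCountableTopology X := TopologicalSpace.firstCountableTopology_induced _ _ g
  exact continuous_iff_seqContinuous.2 fun {xs x} hxs =>
    h xs x ((continuous_induced_dom.tendsto x).comp hxs)

section RiskFunctional

variable {Ω : Type*} [MeasurableSpace Ω] {Ψ : FiniteYoungFunction} {P : Measure Ω}
  [IsProbabilityMeasure P]

theorem FiniteYoungFunction.continuous_gauge (Ψ : FiniteYoungFunction) : Continuous Ψ.gauge :=
  Ψ.continuous'.comp continuous_nnnorm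

theorem continuous_heartLaws_prodMk_lintegral_gauge :
    Continuous[heartLawsTopology Ψ P, inferInstance] (fun μ : heartLaws Ψ P =>
      ((μ : ProbabilityMeasure ℝ),
        ∫⁻ x, (Ψ.gauge x : ℝ≥0∞) ∂((μ : ProbabilityMeasure ℝ) : Measure ℝ))) := by
  let := gaugedTopology Ψ.gauge
  let := heartLawsTopology Ψ P
  have hincl : Continuous (inclusion (heartLaws_subset Ψ P)) := continuous_induced_dom
  exact (continuous_coe_gaugedMeasures.comp hincl).prodMk
    ((continuous_lintegral_gaugedMeasures Ψ.continuous_gauge).comp hincl)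

theorem mem_orliczHeart_of_rvLaw_mem_heartLaws {X : Ω →ₘ[P] ℝ} (h : rvLaw X ∈ heartLaws Ψ P) :
    X ∈ orliczHeart Ψ P := by
  obtain ⟨Y, hY⟩ := h
  have hmap : P.map (Y : Ω →ₘ[P] ℝ) = P.map X := congrArg Subtype.val hY
  intro c _
  change Ψ.modular P c X < ∞
  rw [← FiniteYoungFunction.modular_map c X.aemeasurable, ← hmap,
    FiniteYoungFunction.modular_map c (Y : Ω →ₘ[P] ℝ).aemeasurable]
  exact FiniteYoungFunction.modular_lt_top Y c

theorem IsLawInvariantConvexRiskMeasure.riskFunctional_eq {ρ : orliczHeart Ψ P → ℝ}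
    (hρ : IsLawInvariantConvexRiskMeasure ρ) {X : orliczHeart Ψ P} {μ : heartLaws Ψ P}
    (hX : rvLaw (X : Ω →ₘ[P] ℝ) = μ) : riskFunctional ρ μ = ρ X := by
  rw [← riskFunctional_law hρ X]
  exact congrArg _ (Subtype.ext hX.symm)

theorem IsLawInvariantConvexRiskMeasure.continuous_riskFunctional (hP : IsAtomless P)
    (hΨ : Ψ.Delta2) {ρ : orliczHeart Ψ P → ℝ} (hρ : IsLawInvariantConvexRiskMeasure ρ) :
    Continuous[heartLawsTopology Ψ P, inferInstance] (riskFunctional ρ) := by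
  let := heartLawsTopology Ψ P
  refine continuous_of_forall_seq_tendsto_comp continuous_heartLaws_prodMk_lintegral_gauge
    fun μs μ hμ => ?_
  obtain ⟨X, hlaw, hlim⟩ := hP.exists_skorokhod_representation
  have hmem : ∀ ν : heartLaws Ψ P, X ν ∈ orliczHeart Ψ P := fun ν =>
    mem_orliczHeart_of_rvLaw_mem_heartLaws ((hlaw ν).symm ▸ ν.2)
  let Y : heartLaws Ψ P → orliczHeart Ψ P := fun ν => ⟨X ν, hmem ν⟩
  have hmod : ∀ ν : heartLaws Ψ P, ∫⁻ x, (Ψ.gauge x : ℝ≥0∞) ∂((ν : ProbabilityMeasure ℝ) :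
      Measure ℝ) = Ψ.modular P 1 (X ν) := fun ν => by
    rw [← FiniteYoungFunction.lintegral_gauge_map (X ν).aemeasurable,
      ← show (rvLaw (X ν) : Measure ℝ) = P.map (X ν) from rfl, hlaw]
  have hmodlim : Tendsto (fun n => Ψ.modular P 1 (X (μs n))) atTop (𝓝 (Ψ.modular P 1 (X μ))) := by
    simpa only [Function.comp_def, hmod] using hμ.snd_nhds
  have hYlim : Tendsto (fun n => ρ (Y (μs n))) atTop (𝓝 (ρ (Y μ))) := by
    refine tendsto_of_antitone_of_convexOn hρ.antitone hρ.convex fun c => ?_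
    refine (hΨ.tendsto_modular_sub (fun n => (X (μs n)).aemeasurable) (hlim _ _ hμ.fst_nhds)
      (FiniteYoungFunction.modular_lt_top (Y μ) 1).ne hmodlim c).congr fun n => ?_
    exact FiniteYoungFunction.modular_congr (AEEqFun.coeFn_sub (X (μs n)) (X μ)).symm
  simpa only [Function.comp_def, fun ν => hρ.riskFunctional_eq (X := Y ν) (hlaw ν)] using hYlim

end RiskFunctional

section Shortfall

open scoped Pointwise

variable {Ω : Type*} [MeasurableSpace Ω] {P : Measure Ω} {ℓ : ℝ → ℝ≥0} {x₀ : ℝ≥0}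

theorem measurable_coe_comp_neg_sub (hℓ : Monotone ℓ) (X : Ω →ₘ[P] ℝ) (m : ℝ) :
    Measurable fun ω => (ℓ (-X ω - m) : ℝ≥0∞) :=
  (hℓ.measurable.comp (X.measurable.neg.sub_const m)).coe_nnreal_ennreal

theorem acceptableCash_nonempty (hmono : Monotone ℓ) (hbot : Tendsto ℓ atBot (𝓝 0))
    (hx₀ : 0 < x₀) {X : Ω →ₘ[P] ℝ} (hX : ∫⁻ ω, (ℓ (-X ω) : ℝ≥0∞) ∂P ≠ ∞) :
    (acceptableCash ℓ x₀ X).Nonempty := by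
  have hlim : Tendsto (fun n : ℕ => ∫⁻ ω, (ℓ (-X ω - n) : ℝ≥0∞) ∂P) atTop (𝓝 (∫⁻ _, 0 ∂P)) := by
    refine tendsto_lintegral_of_dominated_convergence _
      (fun n => measurable_coe_comp_neg_sub hmono X n)
      (fun n => ae_of_all _ fun ω => ENNReal.coe_le_coe.2 (hmono (sub_le_self _ n.cast_nonneg)))
      hX (ae_of_all _ fun ω => ?_)
    have hsub : Tendsto (fun n : ℕ => -X ω - n) atTop atBot :=
      tendsto_atBot_add_const_left _ _ (tendsto_neg_atTop_atBot.comp tendsto_natCast_atTop_atTop)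
    exact (ENNReal.continuous_coe.tendsto 0).comp (hbot.comp hsub)
  rw [lintegral_zero] at hlim
  obtain ⟨n, hn⟩ := (hlim.eventually (ge_mem_nhds (ENNReal.coe_pos.2 hx₀))).exists
  exact ⟨n, hn⟩

theorem acceptableCash_bddBelow [NeZero P] (hmono : Monotone ℓ) (htop : Tendsto ℓ atTop atTop)
    (x₀ : ℝ≥0) (X : Ω →ₘ[P] ℝ) : BddBelow (acceptableCash ℓ x₀ X) := by
  have hlim : Tendsto (fun n : ℕ => ∫⁻ ω, (ℓ (-X ω - -n) : ℝ≥0∞) ∂P) atTop (𝓝 (∫⁻ _, ∞ ∂P)) := by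
    refine lintegral_tendsto_of_tendsto_of_monotone
      (fun n => (measurable_coe_comp_neg_sub hmono X _).aemeasurable)
      (ae_of_all _ fun ω i j hij => ENNReal.coe_le_coe.2 (hmono (by gcongr)))
      (ae_of_all _ fun ω => ENNReal.tendsto_coe_nhds_top.2 (htop.comp ?_))
    simp only [sub_neg_eq_add]
    exact tendsto_atTop_add_const_left _ _ tendsto_natCast_atTop_atTop
  rw [lintegral_const, ENNReal.top_mul (NeZero.ne (P univ))] at hlim
  obtain ⟨n, hn⟩ := (hlim.eventually (lt_mem_nhds (ENNReal.coe_lt_top (r := x₀)))).exists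
  refine ⟨-n, fun m hm => le_of_not_gt fun hlt => ?_⟩
  have hle : ∫⁻ ω, (ℓ (-X ω - -n) : ℝ≥0∞) ∂P ≤ ∫⁻ ω, (ℓ (-X ω - m) : ℝ≥0∞) ∂P :=
    lintegral_mono fun ω => ENNReal.coe_le_coe.2 (hmono (by gcongr))
  exact (hn.trans_le (hle.trans hm)).false

theorem acceptableCash_subset (hmono : Monotone ℓ) {X Y : Ω →ₘ[P] ℝ}
    (hXY : ∀ᵐ ω ∂P, X ω ≤ Y ω) : acceptableCash ℓ x₀ X ⊆ acceptableCash ℓ x₀ Y :=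
  fun _ => (lintegral_mono_ae (hXY.mono fun ω hω =>
    ENNReal.coe_le_coe.2 (hmono (by gcongr)))).trans

theorem acceptableCash_eq_of_rvLaw_eq [IsProbabilityMeasure P] (hℓ : Measurable ℓ)
    {X Y : Ω →ₘ[P] ℝ} (hXY : rvLaw X = rvLaw Y) :
    acceptableCash ℓ x₀ X = acceptableCash ℓ x₀ Y := by
  have hmap : P.map X = P.map Y := congrArg Subtype.val hXY
  have hm : ∀ m : ℝ, Measurable fun x : ℝ => (ℓ (-x - m) : ℝ≥0∞) := fun m =>
    (hℓ.comp (measurable_neg.sub_const m)).coe_nnreal_ennreal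
  ext m
  change ∫⁻ ω, (ℓ (-X ω - m) : ℝ≥0∞) ∂P ≤ x₀ ↔ ∫⁻ ω, (ℓ (-Y ω - m) : ℝ≥0∞) ∂P ≤ x₀
  rw [← lintegral_map (hm m) X.measurable, hmap, lintegral_map (hm m) Y.measurable]

theorem smul_acceptableCash_add_subset (hmono : Monotone ℓ) (hconv : ConvexOn ℝ≥0 univ ℓ)
    {s t : ℝ≥0} (hst : s + t = 1) (X Y : Ω →ₘ[P] ℝ) :
    (s : ℝ) • acceptableCash ℓ x₀ X + (t : ℝ) • acceptableCash ℓ x₀ Y ⊆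
      acceptableCash ℓ x₀ ((s : ℝ) • X + (t : ℝ) • Y) := by
  rintro _ ⟨_, ⟨m, hm, rfl⟩, _, ⟨m', hm', rfl⟩, rfl⟩
  calc ∫⁻ ω, (ℓ (-((s : ℝ) • X + (t : ℝ) • Y) ω - ((s : ℝ) • m + (t : ℝ) • m')) : ℝ≥0∞) ∂P
      ≤ ∫⁻ ω, (s * ℓ (-X ω - m) + t * ℓ (-Y ω - m')) ∂P := by
        refine lintegral_mono_ae ?_
        filter_upwards [AEEqFun.coeFn_add ((s : ℝ) • X) ((t : ℝ) • Y),
          AEEqFun.coeFn_smul (s : ℝ) X, AEEqFun.coeFn_smul (t : ℝ) Y] with ω hadd hsX htY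
        have hcomb : -((s : ℝ) • X + (t : ℝ) • Y) ω - ((s : ℝ) • m + (t : ℝ) • m') =
            s • (-X ω - m) + t • (-Y ω - m') := by
          simp only [hadd, Pi.add_apply, hsX, htY, Pi.smul_apply, NNReal.smul_def, smul_eq_mul]
          ring
        rw [hcomb]
        exact_mod_cast hconv.2 (mem_univ (-X ω - m)) (mem_univ (-Y ω - m')) zero_le zero_le hst
    _ = s * ∫⁻ ω, (ℓ (-X ω - m) : ℝ≥0∞) ∂P + t * ∫⁻ ω, (ℓ (-Y ω - m') : ℝ≥0∞) ∂P := by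
        rw [lintegral_add_left ((measurable_coe_comp_neg_sub hmono X m).const_mul _),
          lintegral_const_mul' _ _ ENNReal.coe_ne_top, lintegral_const_mul' _ _ ENNReal.coe_ne_top]
    _ ≤ s * x₀ + t * x₀ := by gcongr <;> assumption
    _ = x₀ := by rw [← add_mul, ← ENNReal.coe_add, hst, ENNReal.coe_one, one_mul]

theorem isLawInvariantConvexRiskMeasure_shortfallRisk [IsProbabilityMeasure P]
    {Ψ : FiniteYoungFunction} (hmono : Monotone ℓ) (hconv : ConvexOn ℝ≥0 univ ℓ)
    (hbot : Tendsto ℓ atBot (𝓝 0)) (htop : Tendsto ℓ atTop atTop)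
    (hint : ∀ X : orliczHeart Ψ P, ∫⁻ ω, (ℓ (-(X : Ω →ₘ[P] ℝ) ω) : ℝ≥0∞) ∂P ≠ ∞) (hx₀ : 0 < x₀) :
    IsLawInvariantConvexRiskMeasure (shortfallRisk Ψ P ℓ x₀) := by
  have hne : ∀ X : orliczHeart Ψ P, (acceptableCash ℓ x₀ (X : Ω →ₘ[P] ℝ)).Nonempty := fun X =>
    acceptableCash_nonempty hmono hbot hx₀ (hint X)
  have hbdd : ∀ X : orliczHeart Ψ P, BddBelow (acceptableCash ℓ x₀ (X : Ω →ₘ[P] ℝ)) := fun X =>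
    acceptableCash_bddBelow hmono htop x₀ _
  refine ⟨fun X Y hXY => csInf_le_csInf (hbdd Y) (hne X) (acceptableCash_subset hmono hXY),
    ⟨convex_univ, fun X _ Y _ s t hs ht hst => ?_⟩,
    fun X Y hXY => congrArg sInf (acceptableCash_eq_of_rvLaw_eq hmono.measurable hXY)⟩
  lift s to ℝ≥0 using hs
  lift t to ℝ≥0 using ht
  calc shortfallRisk Ψ P ℓ x₀ ((s : ℝ) • X + (t : ℝ) • Y)
      ≤ sInf ((s : ℝ) • acceptableCash ℓ x₀ (X : Ω →ₘ[P] ℝ) +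
          (t : ℝ) • acceptableCash ℓ x₀ (Y : Ω →ₘ[P] ℝ)) :=
        csInf_le_csInf (hbdd _) ((hne X).smul_set.add (hne Y).smul_set)
          (smul_acceptableCash_add_subset hmono hconv (by exact_mod_cast hst) _ _)
    _ = (s : ℝ) • shortfallRisk Ψ P ℓ x₀ X + (t : ℝ) • shortfallRisk Ψ P ℓ x₀ Y :=
        (csInf_add (hne X).smul_set ((hbdd X).smul_of_nonneg s.coe_nonneg) (hne Y).smul_set
          ((hbdd Y).smul_of_nonneg t.coe_nonneg)).trans
          (congrArg₂ (· + ·) (Real.sInf_smul_of_nonneg s.coe_nonneg _)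
            (Real.sInf_smul_of_nonneg t.coe_nonneg _))

end Shortfall

namespace FiniteYoungFunction

variable (Ψ : FiniteYoungFunction) {b : ℝ≥0}

theorem monotone_loss (b : ℝ≥0) : Monotone (Ψ.loss b) := fun _ _ h =>
  Ψ.monotone' (by gcongr)

theorem continuous_loss (b : ℝ≥0) : Continuous (Ψ.loss b) :=
  Ψ.continuous'.comp (continuous_const.mul continuous_real_toNNReal)

theorem loss_of_nonpos (b : ℝ≥0) {x : ℝ} (hx : x ≤ 0) : Ψ.loss b x = 0 := by
  rw [loss, Real.toNNReal_of_nonpos hx, mul_zero, Ψ.map_zero']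

theorem convexOn_loss (b : ℝ≥0) : ConvexOn ℝ≥0 univ (Ψ.loss b) := by
  refine ⟨convex_univ, fun x _ y _ s t _ _ hst => ?_⟩
  have htoNNReal : (s • x + t • y).toNNReal ≤ s * x.toNNReal + t * y.toNNReal := by
    rw [Real.toNNReal_le_iff_le_coe]
    push_cast [NNReal.smul_def, smul_eq_mul]
    gcongr <;> exact Real.le_coe_toNNReal _
  calc Ψ.loss b (s • x + t • y) ≤ Ψ (s • (b * x.toNNReal) + t • (b * y.toNNReal)) := by
        refine Ψ.monotone' ((mul_le_mul_right htoNNReal b).trans_eq ?_)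
        simp only [smul_eq_mul]
        ring
    _ ≤ s • Ψ.loss b x + t • Ψ.loss b y := Ψ.convex'.2 trivial trivial zero_le zero_le hst

theorem tendsto_loss_atBot (b : ℝ≥0) : Tendsto (Ψ.loss b) atBot (𝓝 0) :=
  tendsto_const_nhds.congr' <| (eventually_le_atBot 0).mono fun _ hx =>
    (Ψ.loss_of_nonpos b hx).symm

theorem tendsto_loss_atTop (hb : 0 < b) : Tendsto (Ψ.loss b) atTop atTop :=
  Ψ.tendsto_atTop'.comp (tendsto_real_toNNReal_atTop.const_mul_atTop hb)

variable {Ψ} {Ω : Type*} [MeasurableSpace Ω] {P : Measure Ω}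

theorem lintegral_loss_neg_ne_top (b : ℝ≥0) (X : orliczHeart Ψ P) :
    ∫⁻ ω, (Ψ.loss b (-(X : Ω →ₘ[P] ℝ) ω) : ℝ≥0∞) ∂P ≠ ∞ := by
  refine ne_top_of_le_ne_top (modular_lt_top X b).ne (lintegral_mono fun ω => ?_)
  refine ENNReal.coe_le_coe.2 (Ψ.monotone' (mul_le_mul_right ?_ b))
  rw [Real.toNNReal_le_iff_le_coe, coe_nnnorm]
  exact neg_le_abs _

theorem isLawInvariantConvexRiskMeasure_shortfallRisk_loss [IsProbabilityMeasure P] (hb : 0 < b)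
    {x₀ : ℝ≥0} (hx₀ : 0 < x₀) :
    IsLawInvariantConvexRiskMeasure (shortfallRisk Ψ P (Ψ.loss b) x₀) :=
  isLawInvariantConvexRiskMeasure_shortfallRisk (Ψ.monotone_loss b) (Ψ.convexOn_loss b)
    (Ψ.tendsto_loss_atBot b) (Ψ.tendsto_loss_atTop hb) (lintegral_loss_neg_ne_top b) hx₀

end FiniteYoungFunction

section HeartIndicator

variable {Ω : Type*} [MeasurableSpace Ω] {Ψ : FiniteYoungFunction} {P : Measure Ω}

/-- The two-point random variable that equals `a` on the event `A` and `0` elsewhere, as an element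
of the Orlicz heart. -/
noncomputable def heartIndicator (Ψ : FiniteYoungFunction) (P : Measure Ω) [IsFiniteMeasure P]
    {A : Set Ω} (hA : MeasurableSet A) (a : ℝ) : orliczHeart Ψ P :=
  ⟨AEEqFun.mk (A.indicator fun _ => a) (measurable_const.indicator hA).aestronglyMeasurable, by
    refine FiniteYoungFunction.mk_mem_orliczHeart _ fun c => ?_
    refine (lintegral_mono (g := fun _ => (Ψ (c * ‖a‖₊) : ℝ≥0∞)) fun ω =>
      ENNReal.coe_le_coe.2 (Ψ.monotone' (mul_le_mul_right ?_ c))).trans_lt ?_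
    · exact norm_indicator_le_norm_self (fun _ => a) ω
    · rw [lintegral_const]
      exact ENNReal.mul_lt_top ENNReal.coe_lt_top (measure_lt_top P univ)⟩

theorem coeFn_heartIndicator [IsFiniteMeasure P] {A : Set Ω} (hA : MeasurableSet A) (a : ℝ) :
    (heartIndicator Ψ P hA a : Ω →ₘ[P] ℝ) =ᵐ[P] A.indicator fun _ => a :=
  AEEqFun.coeFn_mk _ _

variable [IsProbabilityMeasure P]

theorem integral_rvLaw_zero (g : ℝ → ℝ) (hg : Measurable g) :
    ∫ x, g x ∂(rvLaw (0 : Ω →ₘ[P] ℝ) : Measure ℝ) = g 0 := by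
  calc ∫ x, g x ∂(rvLaw (0 : Ω →ₘ[P] ℝ) : Measure ℝ)
      = ∫ ω, g ((0 : Ω →ₘ[P] ℝ) ω) ∂P :=
        integral_map (AEEqFun.aemeasurable _) hg.aestronglyMeasurable
    _ = ∫ _, g 0 ∂P := integral_congr_ae <|
        (AEEqFun.coeFn_zero (α := Ω) (β := ℝ) (μ := P)).mono fun _ => congrArg g
    _ = g 0 := by simp

theorem integral_rvLaw_heartIndicator {g : ℝ → ℝ} (hg : Measurable g) {A : Set Ω}
    (hA : MeasurableSet A) (a : ℝ) :
    ∫ x, g x ∂(rvLaw (heartIndicator Ψ P hA a : Ω →ₘ[P] ℝ) : Measure ℝ) =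
      g 0 + P.real A * (g a - g 0) := by
  have hind : (fun ω => g ((heartIndicator Ψ P hA a : Ω →ₘ[P] ℝ) ω)) =ᵐ[P]
      fun ω => g 0 + A.indicator (fun _ => g a - g 0) ω := by
    filter_upwards [coeFn_heartIndicator (Ψ := Ψ) (P := P) hA a] with ω hω
    by_cases hωA : ω ∈ A <;> simp [hω, hωA]
  calc ∫ x, g x ∂(rvLaw (heartIndicator Ψ P hA a : Ω →ₘ[P] ℝ) : Measure ℝ)
      = ∫ ω, g ((heartIndicator Ψ P hA a : Ω →ₘ[P] ℝ) ω) ∂P :=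
        integral_map (AEEqFun.aemeasurable _) hg.aestronglyMeasurable
    _ = ∫ ω, g 0 + A.indicator (fun _ => g a - g 0) ω ∂P := integral_congr_ae hind
    _ = g 0 + P.real A * (g a - g 0) := by
        rw [integral_add (integrable_const _) ((integrable_const _).indicator hA),
          integral_indicator_const _ hA]
        simp

theorem tendsto_rvLaw_heartIndicator {ι : Type*} {l : Filter ι} {A : ι → Set Ω}
    (hA : ∀ i, MeasurableSet (A i)) {a : ι → ℝ}
    (h : Tendsto (fun i => P.real (A i) * (1 + Ψ.gauge (a i))) l (𝓝 0)) :
    Tendsto (fun i => (⟨rvLaw (heartIndicator Ψ P (hA i) (a i) : Ω →ₘ[P] ℝ), _, rfl⟩ :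
      heartLaws Ψ P)) l
      (@nhds _ (heartLawsTopology Ψ P) ⟨rvLaw ((0 : orliczHeart Ψ P) : Ω →ₘ[P] ℝ), 0, rfl⟩) := by
  let := gaugedTopology Ψ.gauge
  rw [nhds_induced, tendsto_comap_iff, tendsto_nhds_gaugedTopology_iff]
  rintro g ⟨hg, C, hC⟩
  have hgm : Measurable g := hg.measurable
  have hzero : Tendsto (fun i => P.real (A i) * (g (a i) - g 0)) l (𝓝 0) := by
    refine squeeze_zero_norm (a := fun i => P.real (A i) * (1 + Ψ.gauge (a i)) * (C + |g 0|))
      (fun i => ?_) (by simpa only [zero_mul] using h.mul_const (C + |g 0|))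
    have hpos : (0 : ℝ) < 1 + Ψ.gauge (a i) := by positivity
    have hga : |g (a i)| ≤ C * (1 + Ψ.gauge (a i)) := by
      simpa only [abs_div, abs_of_pos hpos, div_le_iff₀ hpos] using hC (a i)
    have hg0 : |g 0| ≤ |g 0| * (1 + Ψ.gauge (a i)) :=
      le_mul_of_one_le_right (abs_nonneg _) (by simp)
    rw [norm_mul, Real.norm_of_nonneg measureReal_nonneg, Real.norm_eq_abs, mul_assoc]
    gcongr
    linarith [abs_sub (g (a i)) (g 0)]
  have hlaw : ∀ i, ∫ x, g x ∂(rvLaw (heartIndicator Ψ P (hA i) (a i) : Ω →ₘ[P] ℝ) : Measure ℝ) =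
      g 0 + P.real (A i) * (g (a i) - g 0) := fun i => integral_rvLaw_heartIndicator hgm (hA i) _
  simpa only [Function.comp_def, coe_inclusion, hlaw, Submodule.coe_zero,
    integral_rvLaw_zero g hgm, add_zero] using hzero.const_add (g 0)

variable {ℓ : ℝ → ℝ≥0} {x₀ : ℝ≥0}

theorem shortfallRisk_zero_le_neg (hmono : Monotone ℓ) (htop : Tendsto ℓ atTop atTop) {δ : ℝ}
    (hδ : ℓ δ ≤ x₀) : shortfallRisk Ψ P ℓ x₀ 0 ≤ -δ := by
  refine csInf_le (acceptableCash_bddBelow hmono htop x₀ _) ?_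
  calc ∫⁻ ω, (ℓ (-(0 : Ω →ₘ[P] ℝ) ω - -δ) : ℝ≥0∞) ∂P
      = ∫⁻ _, (ℓ δ : ℝ≥0∞) ∂P := by
        refine lintegral_congr_ae ?_
        filter_upwards [AEEqFun.coeFn_zero (α := Ω) (β := ℝ) (μ := P)] with ω hω
        rw [hω, Pi.zero_apply, neg_zero, zero_sub, neg_neg]
    _ ≤ x₀ := by simpa using hδ

theorem shortfallRisk_heartIndicator_neg_nonneg (hmono : Monotone ℓ) {A : Set Ω}
    (hA : MeasurableSet A) {a : ℝ} (hx₀ : x₀ < P A * ℓ a) :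
    0 ≤ shortfallRisk Ψ P ℓ x₀ (heartIndicator Ψ P hA (-a)) := by
  refine Real.sInf_nonneg fun m hm => le_of_not_gt fun hm0 => (hx₀.trans_le ?_).not_ge hm
  calc P A * ℓ a = ∫⁻ ω, A.indicator (fun _ => (ℓ a : ℝ≥0∞)) ω ∂P := by
        rw [lintegral_indicator_const hA, mul_comm]
    _ ≤ ∫⁻ ω, (ℓ (-(heartIndicator Ψ P hA (-a) : Ω →ₘ[P] ℝ) ω - m) : ℝ≥0∞) ∂P := by
        refine lintegral_mono_ae ?_
        filter_upwards [coeFn_heartIndicator (Ψ := Ψ) (P := P) hA (-a)] with ω hω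
        refine indicator_apply_le' (fun hωA => ENNReal.coe_le_coe.2 (hmono ?_)) fun _ => zero_le
        rw [hω, indicator_of_mem hωA]
        linarith

end HeartIndicator

theorem FiniteYoungFunction.exists_seq_of_not_delta2 {Ψ : FiniteYoungFunction} (hΨ : ¬ Ψ.Delta2)
    {b : ℝ≥0} (hb : 1 < b) {x₀ : ℝ≥0} (hx₀ : 0 < x₀) :
    ∃ a p : ℕ → ℝ≥0, (∀ n, p n ≤ 1) ∧ (∀ n, x₀ < p n * Ψ (b * a n)) ∧
      Tendsto (fun n => p n * (1 + Ψ (a n))) atTop (𝓝 0) := by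
  have hgrowth : ∀ n : ℕ, ∃ x, 1 + 2 * x₀ ≤ Ψ x ∧ (n + 1) * Ψ x < Ψ (b * x) := fun n => by
    obtain ⟨x₁, hx₁⟩ := eventually_atTop.1 (Ψ.tendsto_atTop'.eventually_ge_atTop (1 + 2 * x₀))
    by_contra! hno
    exact hΨ ((delta2_iff_exists_mul_le hb).2 ⟨n + 1, x₁, fun x hx => hno x (hx₁ x hx)⟩)
  choose a ha hab using hgrowth
  have hle : ∀ n, Ψ (a n) ≤ Ψ (b * a n) := fun n =>
    Ψ.monotone' (le_mul_of_one_le_left' hb.le)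
  have hpos : ∀ n, 0 < Ψ (b * a n) := fun n => zero_le.trans_lt (hab n)
  refine ⟨a, fun n => 2 * x₀ / Ψ (b * a n), fun n => ?_, fun n => ?_, ?_⟩
  · exact div_le_one_of_le₀ (le_add_self.trans ((ha n).trans (hle n))) zero_le
  · rw [div_mul_cancel₀ _ (hpos n).ne', two_mul]
    exact lt_add_of_pos_right _ hx₀
  · have hzero : Tendsto (fun n : ℕ => 4 * x₀ * (1 / ((n : ℝ≥0) + 1))) atTop (𝓝 0) := by
      simpa only [mul_zero] using tendsto_one_div_add_atTop_nhds_zero_nat.const_mul (4 * x₀)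
    refine tendsto_of_tendsto_of_tendsto_of_le_of_le tendsto_const_nhds hzero (fun _ => zero_le)
      fun n => ?_
    calc 2 * x₀ / Ψ (b * a n) * (1 + Ψ (a n)) ≤ 2 * x₀ / Ψ (b * a n) * (Ψ (a n) + Ψ (a n)) := by
          gcongr
          exact le_self_add.trans (ha n)
      _ = 4 * x₀ * (Ψ (a n) / Ψ (b * a n)) := by ring
      _ ≤ 4 * x₀ * (1 / (n + 1)) := by
          gcongr 4 * x₀ * ?_
          rw [div_le_div_iff₀ (hpos n) (by positivity), one_mul, mul_comm]
          exact (hab n).le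

theorem delta2_of_continuous_riskFunctional_shortfallRisk {Ω : Type*} [MeasurableSpace Ω]
    {Ψ : FiniteYoungFunction} {P : Measure Ω} [IsProbabilityMeasure P] (hP : IsAtomless P)
    {b : ℝ≥0} (hb : 1 < b) {x₀ : ℝ≥0} (hx₀ : 0 < x₀)
    (hcont : Continuous[heartLawsTopology Ψ P, inferInstance]
      (riskFunctional (shortfallRisk Ψ P (Ψ.loss b) x₀))) : Ψ.Delta2 := by
  have hb₀ : 0 < b := one_pos.trans hb
  have hρ := FiniteYoungFunction.isLawInvariantConvexRiskMeasure_shortfallRisk_loss (Ψ := Ψ)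
    (P := P) hb₀ hx₀
  by_contra hΨ
  obtain ⟨a, p, hp, hx₀p, hlim⟩ := FiniteYoungFunction.exists_seq_of_not_delta2 hΨ hb hx₀
  choose A hA hPA using fun n => hP.exists_measure_eq
    (show (p n : ℝ≥0∞) ≤ P univ by simpa using hp n)
  have hlaws := tendsto_rvLaw_heartIndicator (Ψ := Ψ) (P := P) hA (a := fun n => -(a n : ℝ)) (by
    simpa [measureReal_def, hPA, FiniteYoungFunction.gauge] using NNReal.tendsto_coe.2 hlim)
  have hrisk := (@Continuous.tendsto _ _ (heartLawsTopology Ψ P) _ _ hcont _).comp hlaws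
  simp only [Function.comp_def, riskFunctional_law hρ] at hrisk
  have hnonneg : ∀ n, 0 ≤ shortfallRisk Ψ P (Ψ.loss b) x₀
      (heartIndicator Ψ P (hA n) (-(a n : ℝ))) := fun n =>
    shortfallRisk_heartIndicator_neg_nonneg (Ψ.monotone_loss b) (hA n) (by
      rw [hPA, FiniteYoungFunction.loss, Real.toNNReal_coe]
      exact_mod_cast hx₀p n)
  have hloss : ∀ᶠ δ in 𝓝[>] (0 : ℝ), Ψ.loss b δ < x₀ :=
    (((Ψ.continuous_loss b).tendsto 0).eventually
      (gt_mem_nhds (by rwa [Ψ.loss_of_nonpos b le_rfl]))).filter_mono nhdsWithin_le_nhds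
  obtain ⟨δ, hδ, hδ0⟩ := (hloss.and self_mem_nhdsWithin).exists
  have hneg : shortfallRisk Ψ P (Ψ.loss b) x₀ 0 < 0 :=
    (shortfallRisk_zero_le_neg (Ψ.monotone_loss b) (Ψ.tendsto_loss_atTop hb₀) hδ.le).trans_lt
      (neg_lt_zero.2 hδ0)
  exact (ge_of_tendsto' hrisk hnonneg).not_gt hneg

theorem mainTheorem8_general {Ω : Type*} [MeasurableSpace Ω] {P : Measure Ω}
    [IsProbabilityMeasure P] (hP : IsAtomless P) (Ψ : FiniteYoungFunction) {b : ℝ≥0}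
    (hb : 1 < b) :
    ((∀ ρ : orliczHeart Ψ P → ℝ, IsLawInvariantConvexRiskMeasure ρ →
        Continuous[heartLawsTopology Ψ P, inferInstance] (riskFunctional ρ)) ↔ Ψ.Delta2) ∧
    ∀ x₀ : ℝ≥0, 0 < x₀ →
      (∀ X : orliczHeart Ψ P, (acceptableCash (Ψ.loss b) x₀ (X : Ω →ₘ[P] ℝ)).Nonempty ∧
        BddBelow (acceptableCash (Ψ.loss b) x₀ (X : Ω →ₘ[P] ℝ))) ∧
      IsLawInvariantConvexRiskMeasure (shortfallRisk Ψ P (Ψ.loss b) x₀) ∧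
      (Continuous[heartLawsTopology Ψ P, inferInstance]
        (riskFunctional (shortfallRisk Ψ P (Ψ.loss b) x₀)) ↔ Ψ.Delta2) := by
  have hb₀ : 0 < b := one_pos.trans hb
  have hrisk : ∀ x₀ : ℝ≥0, 0 < x₀ →
      IsLawInvariantConvexRiskMeasure (shortfallRisk Ψ P (Ψ.loss b) x₀) := fun _ =>
    FiniteYoungFunction.isLawInvariantConvexRiskMeasure_shortfallRisk_loss hb₀
  have hcont : Ψ.Delta2 → ∀ ρ : orliczHeart Ψ P → ℝ, IsLawInvariantConvexRiskMeasure ρ →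
      Continuous[heartLawsTopology Ψ P, inferInstance] (riskFunctional ρ) := fun hΨ _ hρ =>
    hρ.continuous_riskFunctional hP hΨ
  refine ⟨⟨fun h => ?_, hcont⟩, fun x₀ hx₀ => ⟨fun X => ⟨?_, ?_⟩, hrisk x₀ hx₀, ?_, ?_⟩⟩
  · exact delta2_of_continuous_riskFunctional_shortfallRisk hP hb one_pos (h _ (hrisk 1 one_pos))
  · exact acceptableCash_nonempty (Ψ.monotone_loss b) (Ψ.tendsto_loss_atBot b) hx₀
      (FiniteYoungFunction.lintegral_loss_neg_ne_top b X)
  · exact acceptableCash_bddBelow (Ψ.monotone_loss b) (Ψ.tendsto_loss_atTop hb₀) x₀ _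
  · exact delta2_of_continuous_riskFunctional_shortfallRisk hP hb hx₀
  · exact fun hΨ => hcont hΨ _ (hrisk x₀ hx₀)

theorem mainTheorem8 {Ω : Type*} [MeasurableSpace Ω] (P : Measure Ω) [IsProbabilityMeasure P]
    (hP : IsAtomless P) (Ψ : FiniteYoungFunction) :
    ((∀ ρ : orliczHeart Ψ P → ℝ, IsLawInvariantConvexRiskMeasure ρ →
        Continuous[heartLawsTopology Ψ P, inferInstance] (riskFunctional ρ)) ↔ Ψ.Delta2) ∧
    (¬ Ψ.Delta2 → ∀ x₀ : ℝ≥0, 0 < x₀ →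
      (∀ X : orliczHeart Ψ P, (acceptableCash (Ψ.loss 8) x₀ (X : Ω →ₘ[P] ℝ)).Nonempty ∧
        BddBelow (acceptableCash (Ψ.loss 8) x₀ (X : Ω →ₘ[P] ℝ))) ∧
      IsLawInvariantConvexRiskMeasure (shortfallRisk Ψ P (Ψ.loss 8) x₀) ∧
      ¬ Continuous[heartLawsTopology Ψ P, inferInstance]
          (riskFunctional (shortfallRisk Ψ P (Ψ.loss 8) x₀))) := by
  obtain ⟨hiff, hshortfall⟩ := mainTheorem8_general hP Ψ (b := 8) (by norm_num)
  refine ⟨hiff, fun hΨ x₀ hx₀ => ?_⟩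
  obtain ⟨hwell, hrisk, hcont⟩ := hshortfall x₀ hx₀
  exact ⟨hwell, hrisk, mt hcont.1 hΨ⟩
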